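/- Let $G_8$ be the graph obtained from $K_{3,3,1}$, with parts $\{v\},\{a,b,c\},\{x,y,z\}$, by the $\Delta$–$Y$ exchange on the triangle $vcz$: the edges $vc,cz,vz$ are deleted and a new vertex $w$ is joined to $v,c,z$. A subgraph $M$ of $G_8$ is *maximal planar* if it is planar and the insertion into $M$ of any edge of $G_8$ not in $M$ gives a nonplanar graph (such an $M$ is spanning). Consider the fourteen subgraphs obtained from $G_8$ by removing one of the following sets of edges. Containing all edges at $w$: $\{ax,ay,by\}$, $\{az,by\}$, $\{bz,cy\}$, $\{va,vy,by\}$, $\{vy,bx,by\}$, $\{vb,by,cy\}$, $\{vy,cx,cy\}$. Missing some edge at $w$: $\{vw,ax,by\}$, $\{vw,vb,by\}$, $\{vw,bz\}$, $\{cw,by\}$, $\{cw,vy\}$, $\{cw,bz\}$, $\{vw,cw,vb\}$. (1) Each of the fourteen is a maximal planar subgraph of $G_8$, and no two of them are equivalent under the automorphism group of $G_8$. (2) Every maximal planar subgraph of $G_8$ is isomorphic to one of the fourteen. More precisely, it is equivalent under an automorphism of $G_8$ either to one of the fourteen or to $G_8-\{vb,vy,cy\}$, which is a second copy in $G_8$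 of the graph $G_8-\{vy,bx,by\}$. (3) For every maximal planar subgraph $M$ of $G_8$ (in particular for each of the fourteen) and every embedding of $M$ in the sphere, the strong conflict graph is unbalanced. Here the strong conflict graph is the signed graph whose vertices are the edges of $G_8$ not in $M$ (the $M$-fragments). Extend the embedding of $M$ in $S^2\subset S^3$ to spatial embeddings of $G_8$ in which each fragment lies on one side of the sphere. Two fragments $e,f$ are joined by a negative edge (they strongly conflict) if every such spatial embedding with $e,f$ on the same side of the sphere has a nonsplit link in $M\cup\{e,f\}$, and by a positive edge (they strongly anti-conflict) if every such spatial embedding with $e,f$ on opposite sides has one; a nonsplit link means two disjoint cycles with odd linking number. A signed graph is unbalanced if it has a cycle (possibly of length two) with an odd number of negative edges. -/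

import Mathlib

/-! ### Planar embeddings of finite graphs -/

/-- A combinatorial embedding in the sphere of a finite graph `M`: a rotation system (for every
vertex, a cyclic order of the darts that leave it) of genus zero. An edge has two darts, one for
each direction. For a connected graph, these are exactly the embeddings in the oriented sphere, up
to orientation-preserving homeomorphism. -/
structure PlanarEmbedding {V : Type*} [Finite V] (M : SimpleGraph V) where
  /-- the next dart around the vertex that the dart leaves -/
  rot : Equiv.Perm M.Dart
  rot_fst : ∀ d, (rot d).fst = d.fst
  rot_cyclic : ∀ d d' : M.Dart, d.fst = d'.fst → rot.SameCycle d d'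
  /-- Euler's formula `V + F = E + 2 c`, where `c` is the number of connected components and the
  faces are counted separately for each component: the orbits of the permutation
  `d ↦ rot d.symm`, and one face for every isolated vertex. As the genus of each component is
  nonnegative, the formula says that every component has genus zero. -/
  euler :
    Nat.card V +
        (Nat.card (Quotient (Equiv.Perm.SameCycle.setoid
            ((SimpleGraph.Dart.symm_involutive (G := M)).toPerm.trans rot))) +
          Nat.card {v : V // ∀ w, ¬ M.Adj v w}) =
      Nat.card M.edgeSet + 2 * Nat.card M.ConnectedComponent

/-- A finite graph is planar if it has an embedding in the sphere. -/
def IsPlanar {V : Type*} [Finite V] (M : SimpleGraph V) : Prop :=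
  Nonempty (PlanarEmbedding M)

/-- `M` is a maximal planar subgraph of `G`: it is planar, and the insertion of any edge of `G` that
is not in `M` makes it nonplanar. Such a subgraph is spanning, so it is given by its edges. -/
def IsMaximalPlanarSubgraph {V : Type*} [Finite V] (G M : SimpleGraph V) : Prop :=
  M ≤ G ∧ IsPlanar M ∧
    ∀ e ∈ G.edgeSet \ M.edgeSet, ¬ IsPlanar (M ⊔ SimpleGraph.fromEdgeSet {e})

/-- Two subgraphs of `G` are equivalent under the automorphism group of `G`. -/
def EquivalentUnderAut {V : Type*} (G M N : SimpleGraph V) : Prop :=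
  ∃ σ : G ≃g G, ∀ u v, M.Adj u v ↔ N.Adj (σ u) (σ v)

namespace PlanarEmbedding

variable {V : Type*} [Finite V] {M : SimpleGraph V}

/-- The permutation that walks around the faces: arrive along `d` and leave along the dart that
follows the reverse of `d`. -/
def facePerm (R : PlanarEmbedding M) : Equiv.Perm M.Dart :=
  (SimpleGraph.Dart.symm_involutive (G := M)).toPerm.trans R.rot

/-- The faces of the embedding. -/
def Face (R : PlanarEmbedding M) : Type _ :=
  Quotient (Equiv.Perm.SameCycle.setoid R.facePerm)

/-- The face on the boundary of which the dart `d` is traversed. The other side of the edge of `d`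
is the face of `d.symm`, and the faces around a vertex are the faces of the darts that leave it. -/
def faceOf (R : PlanarEmbedding M) (d : M.Dart) : R.Face :=
  Quotient.mk _ d

/-- `l` lists the edges of `M` crossed by a curve on the sphere that starts in the face `f`, ends in
the face `g`, and meets `M` only by crossing edges: each edge is crossed from the face of the
listed dart `d` to the face of `d.symm`. -/
def IsDualWalk (R : PlanarEmbedding M) : R.Face → List M.Dart → R.Face → Prop
  | f, [], g => f = g
  | f, d :: l, g => R.faceOf d = f ∧ R.IsDualWalk (R.faceOf d.symm) l g

/-- `l` lists the crossings with `M` of a curve on the sphere that joins the two endpoints of `e`. -/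
def IsShadow (R : PlanarEmbedding M) (e : Sym2 V) (l : List M.Dart) : Prop :=
  ∃ d₀ d₁ : M.Dart, e = s(d₀.fst, d₁.fst) ∧ R.IsDualWalk (R.faceOf d₀) l (R.faceOf d₁)

end PlanarEmbedding

/-! ### Spatial placements of the fragments, and linking numbers

`M` is a connected spanning subgraph of `G`, embedded in the sphere `S² ⊂ S³`. Its fragments are
the edges of `G` that are not in `M`. In a spatial embedding of `G` that extends the embedding of
`M`, and in which every fragment lies on one side of the sphere, each fragment is projected to the
sphere as a generic curve between its endpoints. Inside and outside fragments pass
respectively under and over the edges of `M`. -/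

/-- The diagram (as seen from outside of the sphere, with crossing numbers modulo 2) of a spatial
embedding of `G` that extends the embedding `R` of `M`, each fragment being on one side of the
sphere. -/
structure SpatialDiagram {V : Type*} [Finite V] (G : SimpleGraph V) {M : SimpleGraph V}
    (R : PlanarEmbedding M) where
  /-- the fragment lies inside the sphere (otherwise it lies outside) -/
  inside : Sym2 V → Prop
  /-- the crossings with `M` of the projection of a fragment -/
  shadow : Sym2 V → List M.Dart
  isShadow : ∀ e ∈ G.edgeSet \ M.edgeSet, R.IsShadow e (shadow e)
  /-- the number modulo 2 of crossings at which the first fragment is over the second one -/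
  fragmentOver : Sym2 V → Sym2 V → ZMod 2
  /-- an inside fragment never passes over an outside one -/
  fragmentOver_eq_zero : ∀ e ∈ G.edgeSet \ M.edgeSet, ∀ f ∈ G.edgeSet \ M.edgeSet,
    inside e → ¬ inside f → fragmentOver e f = 0

namespace SpatialDiagram

variable {V : Type*} [Finite V] {G M : SimpleGraph V} {R : PlanarEmbedding M}

open Classical in
/-- The number modulo 2 of crossings of the projections of two edges `g`, `h` of `G` at which `g` is
over `h`. -/
noncomputable def overCrossings (P : SpatialDiagram G R) (g h : Sym2 V) : ZMod 2 :=
  if g ∈ M.edgeSet then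
    if h ∈ M.edgeSet then 0
    else if P.inside h then (((P.shadow h).map SimpleGraph.Dart.edge).count g : ZMod 2) else 0
  else
    if h ∈ M.edgeSet then
      if P.inside g then 0 else (((P.shadow g).map SimpleGraph.Dart.edge).count h : ZMod 2)
    else P.fragmentOver g h

/-- The linking number modulo 2 of two disjoint cycles: the parity of the number of crossings at
which the first one is over the second one. -/
noncomputable def linkingNumber (P : SpatialDiagram G R) {u v : V} (C : G.Walk u u)
    (D : G.Walk v v) : ZMod 2 :=
  (C.edges.map fun g => (D.edges.map fun h => P.overCrossings g h).sum).sum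

end SpatialDiagram

/-- A spatial placement of the fragments, given by its diagram. As the projections of two disjoint
cycles are closed curves on the sphere, they cross an even number of times, so the number of
crossings with the first one over the second one has the same parity as the number of those with the
second one over the first one; diagrams that violate this do not come from a spatial embedding. -/
structure SpatialPlacement {V : Type*} [Finite V] (G : SimpleGraph V) {M : SimpleGraph V}
    (R : PlanarEmbedding M) extends SpatialDiagram G R where
  even_crossings : ∀ (u v : V) (C : G.Walk u u) (D : G.Walk v v), C.IsCycle → D.IsCycle →
    C.support.Disjoint D.support →
      toSpatialDiagram.linkingNumber C D = toSpatialDiagram.linkingNumber D C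

/-- In the placement `P`, the subgraph `M ∪ {e, f}` contains a nonsplit link, namely two disjoint
cycles with odd linking number. -/
def SpatialPlacement.Linked {V : Type*} [Finite V] {G M : SimpleGraph V} {R : PlanarEmbedding M}
    (P : SpatialPlacement G R) (e f : Sym2 V) : Prop :=
  ∃ (u v : V) (C : G.Walk u u) (D : G.Walk v v), C.IsCycle ∧ D.IsCycle ∧
    C.support.Disjoint D.support ∧
    (∀ g ∈ C.edges, g ∈ M.edgeSet ∪ {e, f}) ∧ (∀ g ∈ D.edges, g ∈ M.edgeSet ∪ {e, f}) ∧
    P.linkingNumber C D = 1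

theorem SpatialPlacement.Linked.symm {V : Type*} [Finite V] {G M : SimpleGraph V}
    {R : PlanarEmbedding M} {P : SpatialPlacement G R} {e f : Sym2 V} (h : P.Linked e f) :
    P.Linked f e := by
  unfold SpatialPlacement.Linked at h ⊢
  rwa [Set.pair_comm f e]

/-- The fragments `e` and `f` strongly conflict: they cannot be on the same side of the sphere
without producing a nonsplit link, however they are placed there. -/
def StronglyConflict {V : Type*} [Finite V] (G : SimpleGraph V) {M : SimpleGraph V}
    (R : PlanarEmbedding M) (e f : Sym2 V) : Prop :=
  ∀ P : SpatialPlacement G R, (P.inside e ↔ P.inside f) → P.Linked e f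

/-- The fragments `e` and `f` strongly anti-conflict: they cannot be on opposite sides of the sphere
without producing a nonsplit link, however they are placed there. -/
def StronglyAntiConflict {V : Type*} [Finite V] (G : SimpleGraph V) {M : SimpleGraph V}
    (R : PlanarEmbedding M) (e f : Sym2 V) : Prop :=
  ∀ P : SpatialPlacement G R, ¬ (P.inside e ↔ P.inside f) → P.Linked e f

/-! ### Signed graphs and the strong conflict graph -/

/-- A loopless signed graph. Two vertices may be joined by a positive edge, by a negative edge, or by
both. -/
structure SignedGraph (W : Type*) where
  /-- `Edge x y s`: there is an edge of sign `s` between `x` and `y` -/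
  Edge : W → W → ℤˣ → Prop
  symm : ∀ x y s, Edge x y s → Edge y x s
  loopless : ∀ x s, ¬ Edge x x s

/-- A signed graph is balanced if the product of the signs is `1` on each of its cycles: on those of
length two (two parallel edges) and on the longer ones. (For length two, taking twice the same edge
is not excluded, but then the product is `1` anyway.) -/
def SignedGraph.Balanced {W : Type*} (S : SignedGraph W) : Prop :=
  ∀ (n : ℕ) (x : Fin (n + 2) → W) (s : Fin (n + 2) → ℤˣ), Function.Injective x →
    (∀ i, S.Edge (x i) (x (i + 1)) (s i)) → ∏ i, s i = 1

/-- The strong conflict graph of the embedded subgraph `M` of `G`: its vertices are the fragments,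
strong conflicts are the negative edges and strong anti-conflicts the positive ones. -/
def strongConflictGraph {V : Type*} [Finite V] (G : SimpleGraph V) {M : SimpleGraph V}
    (R : PlanarEmbedding M) : SignedGraph {e : Sym2 V // e ∈ G.edgeSet \ M.edgeSet} where
  Edge e f s := e ≠ f ∧
    (s = -1 ∧ StronglyConflict G R e f ∨ s = 1 ∧ StronglyAntiConflict G R e f)
  symm := by
    rintro e f s ⟨hne, ⟨hs, h⟩ | ⟨hs, h⟩⟩
    · exact ⟨hne.symm, Or.inl ⟨hs, fun P hP => (h P hP.symm).symm⟩⟩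
    · exact ⟨hne.symm, Or.inr ⟨hs, fun P hP => (h P fun h' => hP h'.symm).symm⟩⟩
  loopless := fun _ _ h => h.1 rfl

/-! ### The graph `G₈` and the subgraphs -/

/-- The Δ–Y exchange on the triangle `p q r` of `G`: delete the edges of the triangle, and join a new
vertex `none` to `p`, `q` and `r`. -/
def deltaY {V : Type*} (G : SimpleGraph V) (p q r : V) : SimpleGraph (Option V) :=
  (G.deleteEdges {s(p, q), s(q, r), s(p, r)}).map some ⊔
    SimpleGraph.fromEdgeSet {s(none, some p), s(none, some q), s(none, some r)}

/-- The vertices of `K_{3,3,1}`. -/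
inductive K331Vertex : Type
  | v | a | b | c | x | y | z
  deriving DecidableEq

instance : Fintype K331Vertex where
  elems := {.v, .a, .b, .c, .x, .y, .z}
  complete := by
    intro p
    cases p <;> decide

/-- The parts `{v}`, `{a, b, c}`, `{x, y, z}` of the vertex set. -/
def K331Vertex.part : K331Vertex → Fin 3
  | v => 0
  | a => 1
  | b => 1
  | c => 1
  | x => 2
  | y => 2
  | z => 2

/-- The complete tripartite graph `K_{3,3,1}`. -/
def K331 : SimpleGraph K331Vertex :=
  (⊤ : SimpleGraph (Fin 3)).comap K331Vertex.part

/-- The vertices of `G₈`. -/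
abbrev G8Vertex : Type := Option K331Vertex

/-- The graph `G₈`, obtained from `K_{3,3,1}` by the Δ–Y exchange on the triangle `v c z`. -/
def G8 : SimpleGraph G8Vertex :=
  deltaY K331 .v .c .z

namespace G8Vertex

/-- the vertex `v` of degree five -/
abbrev v : G8Vertex := some .v
/-- the vertex `a` -/
abbrev a : G8Vertex := some .a
/-- the vertex `b` -/
abbrev b : G8Vertex := some .b
/-- the vertex `c` -/
abbrev c : G8Vertex := some .c
/-- the vertex `x` -/
abbrev x : G8Vertex := some .x
/-- the vertex `y` -/
abbrev y : G8Vertex := some .y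
/-- the vertex `z` -/
abbrev z : G8Vertex := some .z
/-- the new vertex, of degree three, with the neighbours `v`, `c` and `z` -/
abbrev w : G8Vertex := none

end G8Vertex

open G8Vertex in
/-- The sets of edges that are removed from `G₈`: seven sets without edges of the `Y` formed by
`v w`, `c w`, `z w`, and seven sets with some. -/
def removedEdges : Fin 14 → Set (Sym2 G8Vertex) := ![
  {s(a, x), s(a, y), s(b, y)},
  {s(a, z), s(b, y)},
  {s(b, z), s(c, y)},
  {s(v, a), s(v, y), s(b, y)},
  {s(v, y), s(b, x), s(b, y)},
  {s(v, b), s(b, y), s(c, y)},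
  {s(v, y), s(c, x), s(c, y)},
  {s(v, w), s(a, x), s(b, y)},
  {s(v, w), s(v, b), s(b, y)},
  {s(v, w), s(b, z)},
  {s(c, w), s(b, y)},
  {s(c, w), s(v, y)},
  {s(c, w), s(b, z)},
  {s(v, w), s(c, w), s(v, b)}]

/-- The fourteen subgraphs of `G₈`. -/
def listedSubgraph (i : Fin 14) : SimpleGraph G8Vertex :=
  G8.deleteEdges (removedEdges i)

open G8Vertex in
/-- A subgraph of `G₈` that is isomorphic to the fifth one of the list, but is not its image under an
automorphism of `G₈`. -/
def siblingSubgraph : SimpleGraph G8Vertex :=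
  G8.deleteEdges {s(v, b), s(v, y), s(c, y)}

/-!
The planarity arguments rest on a Jordan curve theorem modulo 2. For a rotation system, the boundary
of a set of faces is always a cycle modulo 2; comparing the dimension of the space of these boundaries
with that of the cycle space shows that the genus is zero if and only if each cycle modulo 2 is the
boundary of a set of faces (`RotationSystem.euler_iff`). Consequences:

* A rotation system restricted to a subgraph still has this property, so subgraphs of planar graphs
  are planar (`IsPlanar.of_hom`).
* A cycle colours the faces by two colours. At a vertex `o` with three edges `o a`, `o b`, `o c`, the
  colours of suitable cycles satisfy a relation that holds for both cyclic orders of the edges, so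
  it does not depend on the embedding (the claw rule, `RotationSystem.claw`). If paths that avoid the
  respective cycles lead from `a`, `b`, `c` to one vertex `q`, the relation says that the sum of the
  cycles separates `o` and `q`. When this sum is zero, or when a path from `o` to `q` avoids it, the
  graph is nonplanar (`G8Vertex.Claw.not_isPlanar`); otherwise some vertices are separated by some
  cycle in *every* embedding (`G8Vertex.Claw.separates`).

*Classification.* The claw rule shows that the 36 minimal nonplanar subgraphs of `G₈` (35 subdivisions
of `K_{3,3}` and one of `K₅`, ten up to symmetry) are nonplanar. A set of edges that meets all of them
contains one of 86 sets, the images of the fifteen sets of the statement under the eight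
automorphisms of `G₈` (`G8Vertex.transversals_obstructionMasks`). Hence each planar subgraph lies
in one of the 86 complements (`G8Vertex.exists_le_of_isPlanar`). Conversely, the complements are
planar, as lists of faces show, and the insertion of an edge creates one of the 36 subgraphs. So they
are exactly the maximal planar subgraphs.

*Conflicts.* Let `e`, `f` be two fragments. If they are on the same side of the sphere, and `C`, `D`
are disjoint cycles through `e` and `f` respectively, the linking number of `C` and `D` is the number
of crossings of `f` with `C`, up to a term that depends only on `e` and `f`. For two such pairs,
the terms cancel, and the sum of the linking numbers is the number of crossings of `f` with the sum of
the two cycles through `e`. It is odd if this sum separates the ends of `f`, and then one of the pairs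
is linked (`stronglyConflict_of_separates`). If `e`, `f` are on opposite sides, and `C` passes through
both of them while `D` is in `M`, the linking number is the number of crossings of one of them
with `D`, and one or two pairs are used in the same way (`stronglyAntiConflict_of_separates`). As the
separations hold in every embedding, each of the fifteen graphs has two fragments that conflict
and anti-conflict strongly, or three fragments whose triangle has an odd number of strong conflicts.

The finite checks are carried out by the kernel, on sets of edges that are encoded as 15-bit masks.
-/

/-! ### Rotation systems and the Jordan curve theorem modulo 2 -/

/-- A rotation system of a graph, of arbitrary genus: a cyclic order of the darts that leave each
vertex. -/
structure RotationSystem {V : Type*} (M : SimpleGraph V) where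
  /-- the next dart around the vertex that the dart leaves -/
  rot : Equiv.Perm M.Dart
  rot_fst : ∀ d, (rot d).fst = d.fst
  rot_cyclic : ∀ d d' : M.Dart, d.fst = d'.fst → rot.SameCycle d d'

/-- The rotation system of a planar embedding. It has definitionally the same faces. -/
def PlanarEmbedding.toRotationSystem {V : Type*} [Finite V] {M : SimpleGraph V}
    (R : PlanarEmbedding M) : RotationSystem M where
  rot := R.rot
  rot_fst := R.rot_fst
  rot_cyclic := R.rot_cyclic

/-- The chain `z` of edges (modulo 2) is a cycle of `M`: its boundary vanishes at each vertex. -/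
def IsEvenChain {V : Type*} [Fintype V] (M : SimpleGraph V) (z : Sym2 V → ZMod 2) : Prop :=
  ∀ v, open Classical in ∑ d : M.Dart, (if d.fst = v then z d.edge else 0) = 0

namespace RotationSystem

variable {V : Type*} {M : SimpleGraph V}

/-- The permutation whose orbits are the faces. -/
def facePerm (R : RotationSystem M) : Equiv.Perm M.Dart :=
  (SimpleGraph.Dart.symm_involutive (G := M)).toPerm.trans R.rot

/-- The faces of a rotation system. -/
def Face (R : RotationSystem M) : Type _ :=
  Quotient (Equiv.Perm.SameCycle.setoid R.facePerm)

/-- The face on the boundary of which the dart is traversed. -/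
def faceOf (R : RotationSystem M) (d : M.Dart) : R.Face :=
  Quotient.mk _ d

/-- The colouring `f` of the faces by two colours changes exactly across the edges of the
chain `z`. -/
def Cobounds (R : RotationSystem M) (f : R.Face → ZMod 2) (z : Sym2 V → ZMod 2) : Prop :=
  ∀ d : M.Dart, f (R.faceOf d) + f (R.faceOf d.symm) = z d.edge

theorem faceOf_facePerm (R : RotationSystem M) (d : M.Dart) :
    R.faceOf (R.facePerm d) = R.faceOf d :=
  Quotient.sound (s := Equiv.Perm.SameCycle.setoid R.facePerm) ⟨-1, by simp⟩

theorem faceOf_symm (R : RotationSystem M) (d : M.Dart) :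
    R.faceOf d.symm = R.faceOf (R.rot d) := by
  rw [← R.faceOf_facePerm d.symm]
  simp [facePerm]

theorem faceOf_surjective (R : RotationSystem M) : Function.Surjective R.faceOf :=
  Quotient.mk_surjective

/-- A function of the darts that is invariant under the face permutation descends to the faces. -/
theorem exists_face_function (R : RotationSystem M) {α : Type*} (g : M.Dart → α)
    (hg : ∀ d, g (R.facePerm d) = g d) : ∃ f : R.Face → α, ∀ d, f (R.faceOf d) = g d := by
  refine ⟨Quotient.lift g ?_, fun d => rfl⟩
  rintro a b ⟨n, rfl⟩
  have key : ∀ n : ℕ, ∀ a, g ((R.facePerm ^ n) a) = g a := by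
    intro n
    induction n with
    | zero => simp
    | succ k ih => intro a; rw [pow_succ, Equiv.Perm.mul_apply, ih, hg]
  cases n with
  | ofNat n => simpa using (key n a).symm
  | negSucc n =>
    have := key (n + 1) ((R.facePerm ^ (Int.negSucc n)) a)
    rw [← this, zpow_negSucc, ← Equiv.Perm.mul_apply, mul_inv_cancel, Equiv.Perm.one_apply]

instance [Finite V] : Finite M.Dart :=
  Finite.of_injective _ SimpleGraph.Dart.toProd_injective

instance [Finite V] (R : RotationSystem M) : Finite R.Face :=
  Finite.of_surjective _ R.faceOf_surjective

theorem Cobounds.rot {R : RotationSystem M} {f : R.Face → ZMod 2} {z : Sym2 V → ZMod 2}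
    (h : R.Cobounds f z) (d : M.Dart) :
    f (R.faceOf (R.rot d)) = f (R.faceOf d) + z d.edge := by
  rw [← h d, R.faceOf_symm, ← add_assoc, CharTwo.add_self_eq_zero, zero_add]

theorem Cobounds.add {R : RotationSystem M} {f g : R.Face → ZMod 2} {z y : Sym2 V → ZMod 2}
    (hf : R.Cobounds f z) (hg : R.Cobounds g y) : R.Cobounds (f + g) (z + y) := by
  intro d
  simp only [Pi.add_apply, ← hf d, ← hg d]
  ring

theorem eq_of_reachable {g : V → ZMod 2} (hg : ∀ u v, M.Adj u v → g u = g v) {u v : V}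
    (h : M.Reachable u v) : g u = g v := by
  obtain ⟨p⟩ := h
  induction p with
  | nil => rfl
  | cons h _ ih => rw [hg _ _ h, ih]

variable [Finite V]

/-- Euler's formula, stated as in the definition of a planar embedding. -/
def Euler (R : RotationSystem M) : Prop :=
  Nat.card V + (Nat.card R.Face + Nat.card {v : V // ∀ w, ¬ M.Adj v w}) =
    Nat.card M.edgeSet + 2 * Nat.card M.ConnectedComponent

/-- The functions on the vertices that are constant on the components. -/
def locallyConstant (M : SimpleGraph V) : Submodule (ZMod 2) (V → ZMod 2) where
  carrier := {g | ∀ u v, M.Adj u v → g u = g v}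
  add_mem' := fun ha hb u v h => by simp [ha u v h, hb u v h]
  zero_mem' := fun _ _ _ => rfl
  smul_mem' := fun c x hx u v h => by simp [hx u v h]

theorem finrank_locallyConstant :
    Module.finrank (ZMod 2) (locallyConstant M) = Nat.card M.ConnectedComponent := by
  have := Fintype.ofFinite M.ConnectedComponent
  let e : (M.ConnectedComponent → ZMod 2) ≃ₗ[ZMod 2] locallyConstant M :=
    { toFun := fun c => ⟨fun v => c (M.connectedComponentMk v), fun u v h => by
        exact congrArg c (SimpleGraph.ConnectedComponent.sound h.reachable)⟩
      map_add' := fun _ _ => rfl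
      map_smul' := fun _ _ => rfl
      invFun := fun g => fun c => c.lift g.1 (fun v w p _ => eq_of_reachable g.2 p.reachable)
      left_inv := fun c => by
        ext x
        induction x using SimpleGraph.ConnectedComponent.ind
        rfl
      right_inv := fun g => by ext; rfl }
  rw [← e.finrank_eq, Module.finrank_fintype_fun_eq_card, Nat.card_eq_fintype_card]

end RotationSystem

namespace RotationSystem

variable {V : Type*} {M : SimpleGraph V}

theorem exists_dart (e : M.edgeSet) : ∃ d : M.Dart, d.edge = e := by
  obtain ⟨e, he⟩ := e
  induction e with
  | _ u v => exact ⟨⟨(u, v), he⟩, rfl⟩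

/-- The coboundary map modulo 2, from the functions on the faces to the functions on the edges. -/
noncomputable def coboundary (R : RotationSystem M) :
    (R.Face → ZMod 2) →ₗ[ZMod 2] (M.edgeSet → ZMod 2) where
  toFun f e := f (R.faceOf (exists_dart e).choose) + f (R.faceOf (exists_dart e).choose.symm)
  map_add' f g := by
    ext e
    simp only [Pi.add_apply]
    ring
  map_smul' c f := by
    ext e
    simp [mul_add]

theorem coboundary_apply (R : RotationSystem M) (f : R.Face → ZMod 2) (d : M.Dart) :
    R.coboundary f ⟨d.edge, d.edge_mem⟩ = f (R.faceOf d) + f (R.faceOf d.symm) := by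
  have h := (exists_dart ⟨d.edge, d.edge_mem⟩).choose_spec
  rcases (SimpleGraph.dart_edge_eq_iff _ _).mp h with h | h
  · simp [coboundary, h]
  · simp [coboundary, h, add_comm]

theorem mem_ker_coboundary (R : RotationSystem M) (f : R.Face → ZMod 2) :
    f ∈ LinearMap.ker R.coboundary ↔ ∀ d, f (R.faceOf d) = f (R.faceOf d.symm) := by
  rw [LinearMap.mem_ker]
  constructor
  · intro h d
    have := congrFun h ⟨d.edge, d.edge_mem⟩
    rw [coboundary_apply] at this
    exact CharTwo.add_eq_zero.mp this
  · intro h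
    ext e
    obtain ⟨d, hd⟩ := exists_dart e
    obtain rfl : (⟨d.edge, d.edge_mem⟩ : M.edgeSet) = e := Subtype.ext hd
    rw [coboundary_apply]
    exact CharTwo.add_eq_zero.mpr (h d)

variable [Fintype V]

open Classical in
/-- The boundary map of `M` modulo 2, as a matrix: the incidence matrix, counted by darts. -/
noncomputable def boundary (M : SimpleGraph V) : Matrix V M.edgeSet (ZMod 2) :=
  fun v e => ∑ d : M.Dart, if d.fst = v ∧ d.edge = e then 1 else 0

open Classical in
theorem boundary_mulVec (y : M.edgeSet → ZMod 2) (v : V) :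
    (boundary M).mulVec y v =
      ∑ d : M.Dart, if d.fst = v then y ⟨d.edge, d.edge_mem⟩ else 0 := by
  simp only [Matrix.mulVec, dotProduct, boundary, Finset.sum_mul]
  rw [Finset.sum_comm]
  refine Finset.sum_congr rfl fun d _ => ?_
  rw [Finset.sum_eq_single ⟨d.edge, d.edge_mem⟩]
  · simp
  · intro e _ he
    rw [if_neg, zero_mul]
    rintro ⟨-, h⟩
    exact he (Subtype.ext h.symm)
  · simp

open Classical in
theorem boundary_transpose_mulVec (g : V → ZMod 2) (d : M.Dart) :
    (boundary M).transpose.mulVec g ⟨d.edge, d.edge_mem⟩ = g d.fst + g d.snd := by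
  simp only [Matrix.mulVec, dotProduct, boundary, Finset.sum_mul, Matrix.transpose_apply]
  rw [Finset.sum_comm]
  have h1 : ∀ d' : M.Dart, (∑ v, (if d'.fst = v ∧ d'.edge = d.edge then 1 else 0) * g v) =
      if d'.edge = d.edge then g d'.fst else 0 := by
    intro d'
    by_cases h : d'.edge = d.edge <;> simp [h]
  rw [Finset.sum_congr rfl fun d' _ => h1 d', ← Finset.sum_filter, SimpleGraph.Dart.edge_fiber,
    Finset.sum_pair d.symm_ne.symm]
  rfl

open Classical in
theorem ker_boundary_transpose :
    LinearMap.ker (boundary M).transpose.mulVecLin = locallyConstant M := by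
  ext g
  simp only [LinearMap.mem_ker, Matrix.mulVecLin_apply]
  constructor
  · intro h u v huv
    have := congrFun h ⟨s(u, v), huv⟩
    exact CharTwo.add_eq_zero.mp ((boundary_transpose_mulVec g ⟨(u, v), huv⟩).symm.trans this)
  · intro h
    ext ⟨e, he⟩
    induction e with
    | _ u v =>
      exact (boundary_transpose_mulVec g ⟨(u, v), he⟩).trans (CharTwo.add_eq_zero.mpr (h u v he))

open Classical in
/-- The dimension of the cycle space. -/
theorem finrank_ker_boundary :
    Module.finrank (ZMod 2) (LinearMap.ker (boundary M).mulVecLin) + Nat.card V =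
      Nat.card M.edgeSet + Nat.card M.ConnectedComponent := by
  classical
  have h1 := (boundary M).mulVecLin.finrank_range_add_finrank_ker
  have h2 := (boundary M).transpose.mulVecLin.finrank_range_add_finrank_ker
  have h3 : (boundary M).transpose.rank = (boundary M).rank := Matrix.rank_transpose _
  rw [ker_boundary_transpose, finrank_locallyConstant] at h2
  rw [Matrix.rank, Matrix.rank] at h3
  simp only [Module.finrank_fintype_fun_eq_card, ← Nat.card_eq_fintype_card] at h1 h2
  omega

open Classical in
/-- The boundary of a set of faces is a cycle: around a vertex, each face is entered and left. -/
theorem range_coboundary_le (R : RotationSystem M) :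
    LinearMap.range R.coboundary ≤ LinearMap.ker (boundary M).mulVecLin := by
  rintro _ ⟨f, rfl⟩
  rw [LinearMap.mem_ker]
  ext v
  rw [Matrix.mulVecLin_apply, boundary_mulVec]
  simp only [coboundary_apply, R.faceOf_symm]
  have h : ∑ d : M.Dart, (if d.fst = v then f (R.faceOf (R.rot d)) else 0) =
      ∑ d : M.Dart, (if d.fst = v then f (R.faceOf d) else 0) := by
    rw [← Equiv.sum_comp R.rot (fun d => if d.fst = v then f (R.faceOf d) else 0)]
    simp only [R.rot_fst]
  calc ∑ d : M.Dart, (if d.fst = v then f (R.faceOf d) + f (R.faceOf (R.rot d)) else 0)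
      = ∑ d : M.Dart, ((if d.fst = v then f (R.faceOf d) else 0) +
          if d.fst = v then f (R.faceOf (R.rot d)) else 0) :=
        Finset.sum_congr rfl fun d _ => by split <;> simp
    _ = 0 := by rw [Finset.sum_add_distrib, h, CharTwo.add_self_eq_zero]

/-- A function in the kernel of the coboundary is constant around each vertex: it defines a function
on the vertices that are not isolated. -/
theorem eq_of_mem_ker_coboundary (R : RotationSystem M) {f : R.Face → ZMod 2}
    (hf : ∀ d, f (R.faceOf d) = f (R.faceOf d.symm)) {d d' : M.Dart} (h : d.fst = d'.fst) :
    f (R.faceOf d) = f (R.faceOf d') := by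
  obtain ⟨n, rfl⟩ := (R.rot_cyclic d d' h).exists_nat_pow_eq
  clear h
  induction n with
  | zero => rfl
  | succ k ih => rw [ih, pow_succ', Equiv.Perm.mul_apply, ← R.faceOf_symm, ← hf]

open Classical in
/-- The kernel of the coboundary consists of the functions that are constant on each component. The
isolated vertices have no darts, so they are missing from it. -/
theorem finrank_ker_coboundary (R : RotationSystem M) :
    Module.finrank (ZMod 2) (LinearMap.ker R.coboundary) +
        Nat.card {v : V // ∀ w, ¬ M.Adj v w} =
      Nat.card M.ConnectedComponent := by
  have : Fintype R.Face := Fintype.ofFinite _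
  let ext : LinearMap.ker R.coboundary × ({v : V // ∀ w, ¬ M.Adj v w} → ZMod 2) → V → ZMod 2 :=
    fun p v => if h : ∃ w, M.Adj v w then p.1.1 (R.faceOf ⟨(v, h.choose), h.choose_spec⟩)
      else p.2 ⟨v, not_exists.mp h⟩
  have hext : ∀ p (d : M.Dart), ext p d.fst = p.1.1 (R.faceOf d) := by
    intro p d
    have h : ∃ w, M.Adj d.fst w := ⟨d.snd, d.adj⟩
    simp only [ext, dif_pos h]
    exact R.eq_of_mem_ker_coboundary ((R.mem_ker_coboundary _).mp p.1.2) rfl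
  have hiso : ∀ p (v : {v : V // ∀ w, ¬ M.Adj v w}), ext p v = p.2 v := by
    intro p v
    simp only [ext, dif_neg (not_exists.mpr v.2)]
  let Φ : (LinearMap.ker R.coboundary × ({v : V // ∀ w, ¬ M.Adj v w} → ZMod 2)) →ₗ[ZMod 2]
      locallyConstant M :=
    { toFun := fun p => ⟨ext p, fun u v h => by
        have h1 := hext p ⟨(u, v), h⟩
        have h2 := hext p (SimpleGraph.Dart.mk (u, v) h).symm
        rw [← (R.mem_ker_coboundary _).mp p.1.2] at h2
        exact h1.trans h2.symm⟩
      map_add' := fun p q => by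
        ext v
        by_cases h : ∃ w, M.Adj v w <;> simp [ext, h]
      map_smul' := fun c p => by
        ext v
        by_cases h : ∃ w, M.Adj v w <;> simp [ext, h] }
  have hbij : Function.Bijective Φ := by
    constructor
    · rw [← LinearMap.ker_eq_bot, LinearMap.ker_eq_bot']
      intro p hp
      have hp' : ∀ v, ext p v = 0 := fun v => congrFun (congrArg Subtype.val hp) v
      refine Prod.ext (Subtype.ext (funext fun F => ?_)) (funext fun v => ?_)
      · obtain ⟨d, rfl⟩ := R.faceOf_surjective F
        exact (hext p d).symm.trans (hp' _)
      · exact (hiso p v).symm.trans (hp' _)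
    · intro g
      obtain ⟨f, hf⟩ := R.exists_face_function (fun d => g.1 d.fst) fun d => by
        change g.1 (R.rot d.symm).fst = _
        rw [R.rot_fst]
        exact (g.2 _ _ d.adj).symm
      refine ⟨⟨⟨f, (R.mem_ker_coboundary f).mpr fun d => ?_⟩, fun v => g.1 v⟩, ?_⟩
      · rw [hf, hf]
        exact g.2 _ _ d.adj
      · refine Subtype.ext (funext fun v => ?_)
        by_cases h : ∃ w, M.Adj v w
        · obtain ⟨w, h⟩ := h
          exact (hext _ ⟨(v, w), h⟩).trans (hf _)
        · exact hiso _ ⟨v, not_exists.mp h⟩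
  have h := (LinearEquiv.ofBijective Φ hbij).finrank_eq
  rw [finrank_locallyConstant, Module.finrank_prod, Module.finrank_fintype_fun_eq_card,
    ← Nat.card_eq_fintype_card] at h
  exact h

theorem card_face (R : RotationSystem M) :
    Nat.card R.Face = Module.finrank (ZMod 2) (LinearMap.range R.coboundary) +
      Module.finrank (ZMod 2) (LinearMap.ker R.coboundary) := by
  have : Fintype R.Face := Fintype.ofFinite _
  rw [R.coboundary.finrank_range_add_finrank_ker, Module.finrank_fintype_fun_eq_card,
    Nat.card_eq_fintype_card]

/-- The genus is nonnegative: one inequality of Euler's formula holds for every rotation system, so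
it is enough to find sufficiently many faces. -/
theorem euler_of_le (R : RotationSystem M)
    (h : Nat.card M.edgeSet + 2 * Nat.card M.ConnectedComponent ≤
      Nat.card V + (Nat.card R.Face + Nat.card {v : V // ∀ w, ¬ M.Adj v w})) : R.Euler := by
  classical
  have h1 := R.card_face
  have h2 := R.finrank_ker_coboundary
  have h3 := finrank_ker_boundary (M := M)
  have h4 := Submodule.finrank_mono R.range_coboundary_le
  unfold Euler
  omega

/-- **Jordan curve theorem modulo 2**: the genus is zero if and only if each cycle modulo 2 is the
boundary of a set of faces. -/
theorem euler_iff (R : RotationSystem M) :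
    R.Euler ↔ ∀ z, IsEvenChain M z → ∃ f, R.Cobounds f z := by
  classical
  have h1 := R.card_face
  have h2 := R.finrank_ker_coboundary
  have h3 := finrank_ker_boundary (M := M)
  constructor
  · intro h z hz
    have h4 : LinearMap.range R.coboundary = LinearMap.ker (boundary M).mulVecLin :=
      Submodule.eq_of_le_of_finrank_eq R.range_coboundary_le (by unfold Euler at h; omega)
    have h5 : (fun e : M.edgeSet => z e) ∈ LinearMap.ker (boundary M).mulVecLin := by
      rw [LinearMap.mem_ker]
      ext v
      rw [Matrix.mulVecLin_apply, boundary_mulVec]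
      exact hz v
    rw [← h4] at h5
    obtain ⟨f, hf⟩ := h5
    exact ⟨f, fun d => by rw [← R.coboundary_apply, hf]⟩
  · intro h
    have h4 : LinearMap.range R.coboundary = LinearMap.ker (boundary M).mulVecLin := by
      refine le_antisymm R.range_coboundary_le fun y hy => ?_
      obtain ⟨f, hf⟩ := h (fun e => if he : e ∈ M.edgeSet then y ⟨e, he⟩ else 0) (by
        intro v
        rw [LinearMap.mem_ker] at hy
        have := congrFun hy v
        rw [Matrix.mulVecLin_apply, boundary_mulVec] at this
        simpa [SimpleGraph.Dart.edge_mem] using this)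
      refine ⟨f, funext fun e => ?_⟩
      obtain ⟨d, hd⟩ := exists_dart e
      obtain rfl : (⟨d.edge, d.edge_mem⟩ : M.edgeSet) = e := Subtype.ext hd
      rw [coboundary_apply, hf d]
      exact dif_pos d.edge_mem
    rw [h4] at h1
    unfold Euler
    omega

end RotationSystem

/-! ### Planarity is inherited by subgraphs -/

/-- The permutation induced by `σ` on a subset (the range of `ι`) by the first return. -/
theorem Equiv.Perm.exists_first_return {α β : Type*} [Finite α] [Finite β] (σ : Equiv.Perm β)
    {ι : α → β} (hι : Function.Injective ι) :
    ∃ τ : Equiv.Perm α,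
      (∀ a, ∃ n : ℕ, ι (τ a) = (σ ^ (n + 1)) (ι a) ∧
        ∀ k, 0 < k → k ≤ n → (σ ^ k) (ι a) ∉ Set.range ι) ∧
      ∀ a b, σ.SameCycle (ι a) (ι b) → τ.SameCycle a b := by
  classical
  have hex : ∀ a, ∃ n : ℕ, (σ ^ (n + 1)) (ι a) ∈ Set.range ι := fun a =>
    ⟨orderOf σ - 1, a, by
      rw [Nat.sub_add_cancel (orderOf_pos σ), pow_orderOf_eq_one, Equiv.Perm.one_apply]⟩
  choose t ht using fun a => Nat.find_spec (hex a)
  have hmin : ∀ a k, 0 < k → k ≤ Nat.find (hex a) → (σ ^ k) (ι a) ∉ Set.range ι := by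
    intro a k hk hk'
    have := Nat.find_min (hex a) (m := k - 1) (by omega)
    rwa [Nat.sub_add_cancel hk] at this
  have hinj' : ∀ a b, Nat.find (hex a) ≤ Nat.find (hex b) → t a = t b → a = b := by
    intro a b hab h
    have h1 : (σ ^ (Nat.find (hex a) + 1)) (ι a) = (σ ^ (Nat.find (hex b) + 1)) (ι b) := by
      rw [← ht, ← ht, h]
    obtain ⟨m, hm⟩ := Nat.exists_eq_add_of_le hab
    rw [hm, show Nat.find (hex a) + m + 1 = Nat.find (hex a) + 1 + m by ring,
      pow_add σ (Nat.find (hex a) + 1) m, Equiv.Perm.mul_apply] at h1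
    have h2 := (σ ^ (Nat.find (hex a) + 1)).injective h1
    rcases Nat.eq_zero_or_pos m with rfl | hpos
    · exact hι (by simpa using h2)
    · exact absurd ⟨a, h2⟩ (hmin b m hpos (by omega))
  have hinj : Function.Injective t := by
    intro a b h
    rcases le_total (Nat.find (hex a)) (Nat.find (hex b)) with h' | h'
    · exact hinj' a b h' h
    · exact (hinj' b a h' h.symm).symm
  let τ : Equiv.Perm α := Equiv.ofBijective t (Finite.injective_iff_bijective.mp hinj)
  refine ⟨τ, fun a => ⟨Nat.find (hex a), ht a, hmin a⟩, fun a b hab => ?_⟩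
  obtain ⟨n, hn⟩ := hab.exists_nat_pow_eq
  induction n using Nat.strong_induction_on generalizing a with
  | _ n ih =>
    rcases Nat.eq_zero_or_pos n with rfl | hpos
    · obtain rfl : a = b := hι (by simpa using hn)
      exact Equiv.Perm.SameCycle.refl _ _
    · have hle : Nat.find (hex a) + 1 ≤ n := by
        by_contra h
        exact hmin a n hpos (by omega) ⟨b, hn.symm⟩
      have h1 : (σ ^ (n - (Nat.find (hex a) + 1))) (ι (t a)) = ι b := by
        rw [ht, ← Equiv.Perm.mul_apply, ← pow_add, Nat.sub_add_cancel hle, hn]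
      have h2 := ih _ (by omega) (t a)
        ⟨(n - (Nat.find (hex a) + 1) : ℕ), by rw [zpow_natCast, h1]⟩ h1
      exact (Equiv.Perm.sameCycle_apply_left (f := τ)).mp h2

theorem PlanarEmbedding.exists_cobounds {V : Type*} [Fintype V] {M : SimpleGraph V}
    (R : PlanarEmbedding M) {z : Sym2 V → ZMod 2} (hz : IsEvenChain M z) :
    ∃ f, R.toRotationSystem.Cobounds f z :=
  R.toRotationSystem.euler_iff.mp R.euler z hz

theorem RotationSystem.isPlanar {V : Type*} [Fintype V] {M : SimpleGraph V}
    (R : RotationSystem M) (h : R.Euler) : IsPlanar M :=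
  ⟨{ rot := R.rot, rot_fst := R.rot_fst, rot_cyclic := R.rot_cyclic, euler := h }⟩

/-- Subgraphs of planar graphs are planar. The rotation system is restricted to the darts of the
subgraph, and the Jordan curve theorem is inherited. -/
theorem IsPlanar.of_hom {V W : Type*} [Fintype V] [Fintype W] {M : SimpleGraph V}
    {N : SimpleGraph W} (φ : M →g N) (hφ : Function.Injective φ) (hN : IsPlanar N) :
    IsPlanar M := by
  classical
  obtain ⟨R⟩ := hN
  have hR : ∀ z, IsEvenChain N z → ∃ f, R.toRotationSystem.Cobounds f z :=
    fun z hz => R.exists_cobounds hz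
  generalize R.toRotationSystem = R at hR
  let ι : M.Dart → N.Dart := φ.mapDart
  have hι : Function.Injective ι := by
    intro d d' h
    have h1 : φ d.fst = φ d'.fst := congrArg (fun d : N.Dart => d.fst) h
    have h2 : φ d.snd = φ d'.snd := congrArg (fun d : N.Dart => d.snd) h
    exact SimpleGraph.Dart.ext _ _ (Prod.ext (hφ h1) (hφ h2))
  have hpow : ∀ (n : ℕ) (d : N.Dart), ((R.rot ^ n) d).fst = d.fst := by
    intro n
    induction n with
    | zero => simp
    | succ k ih => intro d; rw [pow_succ', Equiv.Perm.mul_apply, R.rot_fst, ih]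
  obtain ⟨τ, hτ, hcyc⟩ := R.rot.exists_first_return hι
  let S : RotationSystem M :=
    { rot := τ
      rot_fst := fun d => by
        obtain ⟨n, hn, -⟩ := hτ d
        have h := congrArg (fun d : N.Dart => d.fst) hn
        simp only [hpow] at h
        exact hφ h
      rot_cyclic := fun d d' h => hcyc d d' (R.rot_cyclic _ _ (congrArg φ h)) }
  refine S.isPlanar (S.euler_iff.mpr fun z hz => ?_)
  -- the cycle `z` of `M` as a cycle of `N`
  let y : Sym2 W → ZMod 2 := fun e =>
    ∑ e' : Sym2 V, if e' ∈ M.edgeSet ∧ e'.map φ = e then z e' else 0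
  have hy : ∀ d : M.Dart, y (ι d).edge = z d.edge := by
    intro d
    have hinj := Sym2.map.injective hφ
    have hd : (ι d).edge = d.edge.map φ := rfl
    simp only [y, hd, hinj.eq_iff]
    rw [Finset.sum_eq_single d.edge]
    · simp [d.edge_mem]
    · intro e _ he
      simp [he]
    · simp
  have hy0 : ∀ d : N.Dart, d ∉ Set.range ι → y d.edge = 0 := by
    intro d hd
    refine Finset.sum_eq_zero fun e _ => if_neg ?_
    rintro ⟨he, h⟩
    obtain ⟨d', rfl⟩ := RotationSystem.exists_dart ⟨e, he⟩
    rcases (SimpleGraph.dart_edge_eq_iff d (ι d')).mp h.symm with h | h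
    · exact hd ⟨d', h.symm⟩
    · exact hd ⟨d'.symm, h.symm⟩
  have hyeven : IsEvenChain N y := by
    intro w
    rw [← Finset.sum_subset (Finset.subset_univ (Finset.univ.image ι)), Finset.sum_image hι.injOn]
    · simp only [hy]
      by_cases hw : ∃ v, φ v = w
      · obtain ⟨v, rfl⟩ := hw
        convert hz v using 3 with d
        exact hφ.eq_iff
      · exact Finset.sum_eq_zero fun d _ => if_neg fun h => hw ⟨_, h⟩
    · intro d _ hd
      rw [hy0 d (by simpa using hd)]
      simp
  obtain ⟨f, hf⟩ := hR y hyeven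
  have hstep : ∀ d : M.Dart, f (R.faceOf (ι (τ d))) = f (R.faceOf (ι d)) + z d.edge := by
    intro d
    obtain ⟨n, hn, hn'⟩ := hτ d
    rw [hn]
    clear hn
    induction n with
    | zero => rw [zero_add, pow_one, hf.rot, hy]
    | succ k ih =>
      rw [pow_succ', Equiv.Perm.mul_apply, hf.rot, hy0 _ (hn' (k + 1) (by omega) le_rfl), add_zero]
      exact ih fun j h0 hj => hn' j h0 (by omega)
  obtain ⟨g, hg⟩ := S.exists_face_function (fun d => f (R.faceOf (ι d))) fun d => by
    change f (R.faceOf (ι (τ d.symm))) = _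
    have h1 := hf (ι d)
    rw [hy] at h1
    rw [hstep, SimpleGraph.Dart.edge_symm, ← h1]
    change f (R.faceOf (ι d).symm) + _ = _
    rw [add_comm, add_assoc, CharTwo.add_self_eq_zero, add_zero]
  refine ⟨g, fun d => ?_⟩
  rw [hg, hg, ← hy d]
  exact hf (ι d)

theorem IsPlanar.mono {V : Type*} [Fintype V] {M N : SimpleGraph V} (h : M ≤ N)
    (hN : IsPlanar N) : IsPlanar M :=
  hN.of_hom (SimpleGraph.Hom.ofLE h) fun _ _ h => h

/-! ### The claw rule -/

namespace RotationSystem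

variable {V : Type*} {M : SimpleGraph V} {R : RotationSystem M}

open Classical in
/-- The colour of the face on the boundary of which the edge `u v` is traversed from `u` to `v`. -/
noncomputable def colour (R : RotationSystem M) (f : R.Face → ZMod 2) (u v : V) : ZMod 2 :=
  if h : M.Adj u v then f (R.faceOf ⟨(u, v), h⟩) else 0

/-- The vertex `v` does not lie on the chain `z`. -/
def IsOff (M : SimpleGraph V) (z : Sym2 V → ZMod 2) (v : V) : Prop :=
  ∀ w, M.Adj v w → z s(v, w) = 0

theorem colour_fst_snd (f : R.Face → ZMod 2) (d : M.Dart) :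
    R.colour f d.fst d.snd = f (R.faceOf d) :=
  dif_pos d.adj

theorem colour_add (f g : R.Face → ZMod 2) (u v : V) :
    R.colour (f + g) u v = R.colour f u v + R.colour g u v := by
  unfold colour
  split <;> simp

variable {f : R.Face → ZMod 2} {z : Sym2 V → ZMod 2}

/-- Between two darts `d` and `(rot ^ n) d`, the colour changes once if only the first of the edges
in between is in the chain. -/
theorem Cobounds.rot_pow (h : R.Cobounds f z) (d : M.Dart) (n : ℕ) (hn : 0 < n)
    (hz : ∀ k, 0 < k → k < n → z ((R.rot ^ k) d).edge = 0) :
    f (R.faceOf ((R.rot ^ n) d)) = f (R.faceOf d) + z d.edge := by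
  induction n, hn using Nat.le_induction with
  | base => simp [h.rot]
  | succ n hn ih =>
    rw [pow_succ', Equiv.Perm.mul_apply, h.rot, hz n hn (by omega), add_zero]
    exact ih fun k h0 hk => hz k h0 (by omega)

theorem Cobounds.colour_symm (h : R.Cobounds f z) {u v : V} (huv : M.Adj u v)
    (hz : z s(u, v) = 0) : R.colour f v u = R.colour f u v := by
  have h1 := h ⟨(u, v), huv⟩
  rw [← colour_fst_snd f ⟨(u, v), huv⟩, ← colour_fst_snd f (SimpleGraph.Dart.symm _)] at h1
  exact (CharTwo.add_eq_zero.mp (h1.trans hz)).symm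

open Classical in
/-- The local form of the claw rule, if `c` comes before `b` in the rotation that starts at `a`: the
chain `z₂` contains only `a` and `c` among the darts at the vertex, and `z₃` only `a` and `b`. -/
theorem claw_of_order {f₂ f₃ : R.Face → ZMod 2} {z₂ z₃ : Sym2 V → ZMod 2}
    (h₂ : R.Cobounds f₂ z₂) (h₃ : R.Cobounds f₃ z₃) {a b c : M.Dart}
    {i j : ℕ} (hi : (R.rot ^ i) a = b) (hi' : ∀ k < i, (R.rot ^ k) a ≠ b)
    (hj : (R.rot ^ j) a = c) (hj' : ∀ k < j, (R.rot ^ k) a ≠ c) (hij : j < i)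
    (hac : a ≠ c)
    (hz₂ : ∀ d : M.Dart, d.fst = a.fst → z₂ d.edge = if d = a ∨ d = c then 1 else 0)
    (hz₃ : ∀ d : M.Dart, d.fst = a.fst → z₃ d.edge = if d = a ∨ d = b then 1 else 0) :
    f₂ (R.faceOf b) + f₃ (R.faceOf c) = 1 + (f₂ (R.faceOf a) + f₃ (R.faceOf a)) := by
  have hfst : ∀ (n : ℕ), ((R.rot ^ n) a).fst = a.fst := by
    intro n
    induction n with
    | zero => simp
    | succ k ih => rw [pow_succ', Equiv.Perm.mul_apply, R.rot_fst, ih]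
  have hj0 : 0 < j := by
    rcases Nat.eq_zero_or_pos j with rfl | h
    · exact absurd (by simpa using hj) hac
    · exact h
  -- no dart is met twice before `b` is reached
  have hinj : ∀ k l, k < l → l ≤ i → (R.rot ^ k) a ≠ (R.rot ^ l) a := by
    intro k l hkl hl h
    refine hi' (i - (l - k)) (by omega) ?_
    rw [← hi]
    conv_rhs => rw [show i = (i - l) + l by omega, pow_add, Equiv.Perm.mul_apply, ← h,
      ← Equiv.Perm.mul_apply, ← pow_add]
    congr 2
    omega
  have e3 : f₃ (R.faceOf c) = f₃ (R.faceOf a) + 1 := by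
    rw [← hj, h₃.rot_pow a j hj0, hz₃ a rfl, if_pos (Or.inl rfl)]
    intro k h0 hk
    rw [hz₃ _ (hfst k), if_neg]
    rintro (h | h)
    · exact hinj 0 k h0 (by omega) (by simpa using h.symm)
    · exact hi' k (by omega) h
  have e2 : f₂ (R.faceOf c) = f₂ (R.faceOf a) + 1 := by
    rw [← hj, h₂.rot_pow a j hj0, hz₂ a rfl, if_pos (Or.inl rfl)]
    intro k h0 hk
    rw [hz₂ _ (hfst k), if_neg]
    rintro (h | h)
    · exact hinj 0 k h0 (by omega) (by simpa using h.symm)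
    · exact hj' k hk h
  have e2' : f₂ (R.faceOf b) = f₂ (R.faceOf c) + 1 := by
    have hb : b = (R.rot ^ (i - j)) c := by
      rw [← hj, ← Equiv.Perm.mul_apply, ← pow_add, Nat.sub_add_cancel hij.le, hi]
    have hc : c.fst = a.fst := by rw [← hj, hfst]
    rw [hb, h₂.rot_pow c (i - j) (by omega), hz₂ c hc, if_pos (Or.inr rfl)]
    intro k h0 hk
    rw [← hj, ← Equiv.Perm.mul_apply, ← pow_add, hz₂ _ (hfst _), if_neg]
    rintro (h | h)
    · exact hinj 0 (k + j) (by omega) (by omega) (by simpa using h.symm)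
    · exact hinj j (k + j) (by omega) (by omega) (hj.trans h.symm)
  rw [e3, e2', e2]
  ring_nf
  have : (3 : ZMod 2) = 1 := rfl
  rw [this]

variable [Finite V]

/-- All faces around a vertex off the chain have the same colour. -/
theorem Cobounds.colour_eq_of_isOff (h : R.Cobounds f z) {v u w : V} (hv : IsOff M z v)
    (hu : M.Adj v u) (hw : M.Adj v w) : R.colour f v u = R.colour f v w := by
  obtain ⟨n, hn⟩ := (R.rot_cyclic ⟨(v, u), hu⟩ ⟨(v, w), hw⟩ rfl).exists_nat_pow_eq
  have key : ∀ (n : ℕ) (d : M.Dart), d.fst = v → f (R.faceOf ((R.rot ^ n) d)) = f (R.faceOf d) := by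
    intro n
    induction n with
    | zero => intro d _; rfl
    | succ k ih =>
      intro d hd
      rw [pow_succ, Equiv.Perm.mul_apply, ih _ ((R.rot_fst d).trans hd), h.rot]
      have : z d.edge = 0 := by
        subst hd
        exact hv _ d.adj
      rw [this, add_zero]
  have := key n ⟨(v, u), hu⟩ rfl
  rw [hn, ← colour_fst_snd f ⟨(v, u), hu⟩, ← colour_fst_snd f ⟨(v, w), hw⟩] at this
  exact this.symm

/-- A colour is constant along a path that does not meet the chain, except perhaps at its first
vertex. -/
theorem Cobounds.colour_eq_of_path (h : R.Cobounds f z) {u v q t : V} {l : List V}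
    (hl : (u :: v :: l).IsChain M.Adj) (hz : ∀ w ∈ v :: l, IsOff M z w)
    (hq : (v :: l).getLast? = some q) (ht : M.Adj q t) :
    R.colour f q t = R.colour f u v := by
  induction l generalizing u v with
  | nil =>
    obtain rfl : v = q := by simpa using hq
    have huv : M.Adj u v := by simpa using hl
    have hv := hz v (by simp)
    rw [h.colour_eq_of_isOff hv ht huv.symm]
    exact h.colour_symm huv (by rw [Sym2.eq_swap]; exact hv _ huv.symm)
  | cons w l ih =>
    rw [List.isChain_cons_cons] at hl
    have huv : M.Adj u v := hl.1
    have hvw : M.Adj v w := (List.isChain_cons_cons.mp hl.2).1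
    have hv := hz v (by simp)
    rw [ih hl.2 (fun x hx => hz x (List.mem_cons_of_mem _ hx)) (by simpa using hq),
      h.colour_eq_of_isOff hv hvw huv.symm]
    exact h.colour_symm huv (by rw [Sym2.eq_swap]; exact hv _ huv.symm)

open Classical in
/-- The **claw rule** at a vertex `o` with edges `o a`, `o b`, `o c`: the cycle `z₂` passes through
`o a` and `o c`, and the cycle `z₃` through `o a` and `o b`. The colours that the two cycles give to
`o b` and to `o c` determine each other in terms of the colour of `o a`, in the same way for
both cyclic orders of the three edges. -/
theorem claw {f₂ f₃ : R.Face → ZMod 2} {z₂ z₃ : Sym2 V → ZMod 2}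
    (h₂ : R.Cobounds f₂ z₂) (h₃ : R.Cobounds f₃ z₃) {o a b c : V}
    (ha : M.Adj o a) (hb : M.Adj o b) (hc : M.Adj o c) (hab : a ≠ b) (hbc : b ≠ c) (hac : a ≠ c)
    (hz₂ : ∀ t, M.Adj o t → z₂ s(o, t) = if t = a ∨ t = c then 1 else 0)
    (hz₃ : ∀ t, M.Adj o t → z₃ s(o, t) = if t = a ∨ t = b then 1 else 0) :
    R.colour f₂ o b + R.colour f₃ o c = 1 + R.colour (f₂ + f₃) o a := by
  have hex : ∀ d : M.Dart, d.fst = o → ∃ n : ℕ, (R.rot ^ n) (SimpleGraph.Dart.mk (o, a) ha) = d :=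
    fun d hd => (R.rot_cyclic _ _ hd.symm).exists_nat_pow_eq
  have hdart : ∀ (t : V) (ht : M.Adj o t) (d : M.Dart), d.fst = o →
      (d = ⟨(o, t), ht⟩ ↔ d.snd = t) := by
    rintro t ht d rfl
    exact ⟨fun h => by rw [h], fun h => SimpleGraph.Dart.ext _ _ (Prod.ext rfl h)⟩
  have hz₂' : ∀ d : M.Dart, d.fst = o → z₂ d.edge =
      if d = ⟨(o, a), ha⟩ ∨ d = ⟨(o, c), hc⟩ then 1 else 0 := by
    intro d hd
    simp only [hdart a ha d hd, hdart c hc d hd]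
    subst hd
    exact hz₂ _ d.adj
  have hz₃' : ∀ d : M.Dart, d.fst = o → z₃ d.edge =
      if d = ⟨(o, a), ha⟩ ∨ d = ⟨(o, b), hb⟩ then 1 else 0 := by
    intro d hd
    simp only [hdart a ha d hd, hdart b hb d hd]
    subst hd
    exact hz₃ _ d.adj
  have hac' : SimpleGraph.Dart.mk (o, a) ha ≠ ⟨(o, c), hc⟩ := by simpa using hac
  have hab' : SimpleGraph.Dart.mk (o, a) ha ≠ ⟨(o, b), hb⟩ := by simpa using hab
  have hbc' : SimpleGraph.Dart.mk (o, b) hb ≠ ⟨(o, c), hc⟩ := by simpa using hbc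
  rw [colour_add]
  simp only [colour, ha, hb, hc, dif_pos]
  have hi := Nat.find_spec (hex ⟨(o, b), hb⟩ rfl)
  have hj := Nat.find_spec (hex ⟨(o, c), hc⟩ rfl)
  have hi' := fun k hk => Nat.find_min (hex ⟨(o, b), hb⟩ rfl) (m := k) hk
  have hj' := fun k hk => Nat.find_min (hex ⟨(o, c), hc⟩ rfl) (m := k) hk
  rcases lt_trichotomy (Nat.find (hex ⟨(o, b), hb⟩ rfl)) (Nat.find (hex ⟨(o, c), hc⟩ rfl)) with
    h | h | h
  · have := claw_of_order h₃ h₂ hj hj' hi hi' h hab' hz₃' hz₂'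
    rw [add_comm, this, add_comm (f₃ _)]
  · rw [h, hj] at hi
    exact absurd hi.symm hbc'
  · exact claw_of_order h₂ h₃ hi hi' hj hj' h hac' hz₂' hz₃'

end RotationSystem

/-! ### Linking numbers of placements -/

/-- The chain `z` separates the vertices `p` and `q`: it bounds a set of faces that contains all faces
around one of them, and none of the faces around the other one. -/
def RotationSystem.Separates {V : Type*} {M : SimpleGraph V} (R : RotationSystem M)
    (z : Sym2 V → ZMod 2) (p q : V) : Prop :=
  ∃ f, R.Cobounds f z ∧
    ∀ d d' : M.Dart, d.fst = p → d'.fst = q → f (R.faceOf d) + f (R.faceOf d') = 1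

section Linking

variable {V : Type*} [Finite V] {G M : SimpleGraph V} {R : PlanarEmbedding M}

theorem PlanarEmbedding.IsDualWalk.sum_eq {F F' : R.Face} {l : List M.Dart}
    (h : R.IsDualWalk F l F') {f : R.toRotationSystem.Face → ZMod 2} {z : Sym2 V → ZMod 2}
    (hf : R.toRotationSystem.Cobounds f z) : (l.map fun d => z d.edge).sum = f F + f F' := by
  induction l generalizing F with
  | nil =>
    obtain rfl : F = F' := h
    simp [CharTwo.add_self_eq_zero]
  | cons d l ih =>
    obtain ⟨rfl, h⟩ := h
    rw [List.map_cons, List.sum_cons, ih h, ← hf d]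
    change f (R.faceOf d) + f (R.faceOf d.symm) + (f (R.faceOf d.symm) + f F') = _
    rw [add_assoc, ← add_assoc (f (R.faceOf d.symm)), CharTwo.add_self_eq_zero, zero_add]

/-- A curve between two vertices that are separated by a cycle modulo 2 crosses it an odd number of
times. -/
theorem PlanarEmbedding.IsShadow.sum_eq_one {p q : V} {l : List M.Dart}
    (h : R.IsShadow s(p, q) l) {z : Sym2 V → ZMod 2}
    (hz : R.toRotationSystem.Separates z p q) : (l.map fun d => z d.edge).sum = 1 := by
  obtain ⟨f, hf, hsep⟩ := hz
  obtain ⟨d, d', he, hl⟩ := h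
  rw [hl.sum_eq hf]
  rcases Sym2.eq_iff.mp he with ⟨hp, hq⟩ | ⟨hp, hq⟩
  · exact hsep d d' hp.symm hq.symm
  · rw [add_comm]
    exact hsep d' d hp.symm hq.symm

theorem List.sum_count_comm {α : Type*} [DecidableEq α] (l l' : List α) :
    (l.map fun a => (l'.count a : ZMod 2)).sum = (l'.map fun b => (l.count b : ZMod 2)).sum := by
  induction l with
  | nil => simp
  | cons a l ih =>
    rw [List.map_cons, List.sum_cons, ih]
    clear ih
    induction l' with
    | nil => simp
    | cons b l' ih =>
      simp only [List.map_cons, List.sum_cons, List.count_cons, Nat.cast_add] at ih ⊢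
      rw [← ih]
      by_cases h : a = b
      · subst h
        simp
        ring
      · simp [h, Ne.symm h]
        ring

open Classical in
/-- The number modulo 2 of crossings of the projection of the fragment `f` with the edges of the
list `l`. -/
noncomputable def SpatialPlacement.crossings (P : SpatialPlacement G R) (f : Sym2 V)
    (l : List (Sym2 V)) : ZMod 2 :=
  ((P.shadow f).map fun d => (l.count d.edge : ZMod 2)).sum

theorem SpatialPlacement.crossings_eq (P : SpatialPlacement G R) (f : Sym2 V)
    (l : List (Sym2 V)) : open Classical in
    P.crossings f l =
      (l.map fun g => (((P.shadow f).map SimpleGraph.Dart.edge).count g : ZMod 2)).sum := by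
  classical
  rw [List.sum_count_comm, List.map_map]
  rfl

open Classical in
/-- An edge that is not in `M` is not crossed by a shadow. -/
theorem SpatialPlacement.count_shadow_eq_zero (P : SpatialPlacement G R) {e : Sym2 V}
    (he : e ∉ M.edgeSet) (f : Sym2 V) :
    ((P.shadow f).map SimpleGraph.Dart.edge).count e = 0 := by
  rw [List.count_eq_zero, List.mem_map]
  rintro ⟨d, -, rfl⟩
  exact he d.edge_mem

theorem SpatialPlacement.crossings_cons (P : SpatialPlacement G R) {e : Sym2 V}
    (he : e ∉ M.edgeSet) (f : Sym2 V) (l : List (Sym2 V)) :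
    P.crossings f (e :: l) = P.crossings f l := by
  classical
  rw [P.crossings_eq, P.crossings_eq, List.map_cons, List.sum_cons, P.count_shadow_eq_zero he,
    Nat.cast_zero, zero_add]

theorem SpatialPlacement.crossings_perm (P : SpatialPlacement G R) (f : Sym2 V)
    {l l' : List (Sym2 V)} (h : l.Perm l') : P.crossings f l = P.crossings f l' := by
  classical
  simp only [crossings, h.count_eq]

theorem SpatialPlacement.crossings_add (P : SpatialPlacement G R) (f : Sym2 V)
    (l l' : List (Sym2 V)) {z : Sym2 V → ZMod 2}
    (hz : open Classical in ∀ g ∈ M.edgeSet, z g = l.count g + l'.count g) :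
    P.crossings f l + P.crossings f l' = ((P.shadow f).map fun d => z d.edge).sum := by
  classical
  rw [crossings, crossings, ← List.sum_map_add]
  congr 1
  refine List.map_congr_left fun d _ => ?_
  rw [hz _ d.edge_mem]

theorem SpatialPlacement.linkingNumber_perm (P : SpatialPlacement G R) {u v : V} {C : G.Walk u u}
    {D : G.Walk v v} {l l' : List (Sym2 V)} (hC : C.edges.Perm l) (hD : D.edges.Perm l') :
    P.linkingNumber C D = (l.map fun g => (l'.map fun h => P.overCrossings g h).sum).sum := by
  rw [SpatialDiagram.linkingNumber, (hC.map _).sum_eq]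
  congr 1
  exact List.map_congr_left fun g _ => (hD.map _).sum_eq

theorem SpatialPlacement.sum_overCrossings_eq_zero (P : SpatialPlacement G R) {g : Sym2 V}
    {l : List (Sym2 V)} (hg : g ∈ M.edgeSet) (hl : ∀ h ∈ l, h ∈ M.edgeSet) :
    (l.map fun h => P.overCrossings g h).sum = 0 := by
  refine List.sum_eq_zero fun x hx => ?_
  obtain ⟨h, hh, rfl⟩ := List.mem_map.mp hx
  simp [SpatialDiagram.overCrossings, hg, hl h hh]

/-- Two vertex-disjoint cycles. -/
structure IsCyclePair {u v : V} (C : G.Walk u u) (D : G.Walk v v) : Prop where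
  left : C.IsCycle
  right : D.IsCycle
  disjoint : C.support.Disjoint D.support

theorem exists_perm_cons {V : Type*} {M : SimpleGraph V} {l : List (Sym2 V)} (hl : l.Nodup)
    {e : Sym2 V} (he : e ∈ l)
    (h : ∀ g ∈ l, g = e ∨ g ∈ M.edgeSet) :
    ∃ l', l.Perm (e :: l') ∧ ∀ g ∈ l', g ∈ M.edgeSet := by
  classical
  refine ⟨l.erase e, List.perm_cons_erase he, fun g hg => ?_⟩
  have := (List.Nodup.mem_erase_iff hl).mp hg
  exact (h g this.2).resolve_left this.1

/-- If `e` and `f` are on the same side, the linking number of two cycles through `e` and `f`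
respectively is given by the crossings of `f` with the first cycle, up to a term that is the same for
all such pairs of cycles. -/
theorem SpatialPlacement.linkingNumber_of_same_side (P : SpatialPlacement G R) {e f : Sym2 V}
    (he : e ∉ M.edgeSet) (hf : f ∉ M.edgeSet) (hef : P.inside e ↔ P.inside f) {u v : V}
    {C : G.Walk u u} {D : G.Walk v v} (h : IsCyclePair C D) (heC : e ∈ C.edges)
    (hfD : f ∈ D.edges) (hC : ∀ g ∈ C.edges, g = e ∨ g ∈ M.edgeSet)
    (hD : ∀ g ∈ D.edges, g = f ∨ g ∈ M.edgeSet) : open Classical in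
    P.linkingNumber C D = (if P.inside e then P.fragmentOver e f else P.fragmentOver f e) +
      P.crossings f C.edges := by
  classical
  obtain ⟨A, hA, hA'⟩ := exists_perm_cons h.left.edges_nodup heC hC
  obtain ⟨B, hB, hB'⟩ := exists_perm_cons h.right.edges_nodup hfD hD
  rw [P.crossings_perm f hA, P.crossings_cons he, P.crossings_eq]
  by_cases hin : P.inside e
  -- inside fragments pass under `M`, so the crossings with `C` over `D` are those of `f` with `C`
  · have hin' := hef.mp hin
    rw [P.linkingNumber_perm hA hB, if_pos hin, List.map_cons, List.sum_cons, List.map_cons,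
      List.sum_cons]
    congr 1
    · rw [List.sum_eq_zero, add_zero]
      · simp [SpatialDiagram.overCrossings, he, hf]
      · intro x hx
        obtain ⟨h, hh, rfl⟩ := List.mem_map.mp hx
        simp [SpatialDiagram.overCrossings, he, hB' h hh, hin]
    · congr 1
      refine List.map_congr_left fun g hg => ?_
      rw [List.map_cons, List.sum_cons, P.sum_overCrossings_eq_zero (hA' g hg) hB', add_zero]
      simp [SpatialDiagram.overCrossings, hA' g hg, hf, hin']
  -- outside fragments pass over `M`, so those crossings have `D` over `C`
  · have hin' : ¬ P.inside f := fun h => hin (hef.mpr h)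
    rw [P.even_crossings u v C D h.left h.right h.disjoint, P.linkingNumber_perm hB hA, if_neg hin,
      List.map_cons, List.sum_cons, List.map_cons, List.sum_cons, add_assoc]
    congr 1
    · simp [SpatialDiagram.overCrossings, he, hf]
    · have h0 : (B.map fun g => ((e :: A).map fun h => P.overCrossings g h).sum).sum = 0 := by
        refine List.sum_eq_zero fun x hx => ?_
        obtain ⟨g, hg, rfl⟩ := List.mem_map.mp hx
        rw [List.map_cons, List.sum_cons, P.sum_overCrossings_eq_zero (hB' g hg) hA', add_zero]
        simp [SpatialDiagram.overCrossings, hB' g hg, he, hin]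
      rw [h0, add_zero]
      congr 1
      refine List.map_congr_left fun g hg => ?_
      simp [SpatialDiagram.overCrossings, hA' g hg, hf, hin']

/-- If `e` and `f` are on opposite sides, the linking number of a cycle through both and a cycle of
`M` is given by the crossings of `e` with the latter. -/
theorem SpatialPlacement.linkingNumber_of_opposite_sides (P : SpatialPlacement G R)
    {e f : Sym2 V} (he : e ∉ M.edgeSet) (hf : f ∉ M.edgeSet)
    (hne : e ≠ f) (hef : ¬ (P.inside e ↔ P.inside f)) {u v : V}
    {C : G.Walk u u} {D : G.Walk v v} (h : IsCyclePair C D) (heC : e ∈ C.edges)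
    (hfC : f ∈ C.edges) (hC : ∀ g ∈ C.edges, g = e ∨ g = f ∨ g ∈ M.edgeSet)
    (hD : ∀ g ∈ D.edges, g ∈ M.edgeSet) :
    P.linkingNumber C D = P.crossings e D.edges := by
  classical
  obtain ⟨A, hA, hA'⟩ : ∃ A, C.edges.Perm (e :: f :: A) ∧ ∀ g ∈ A, g ∈ M.edgeSet := by
    have hnd := h.left.edges_nodup
    refine ⟨(C.edges.erase e).erase f, (List.perm_cons_erase heC).trans
      (List.Perm.cons e (List.perm_cons_erase
        ((List.Nodup.mem_erase_iff hnd).mpr ⟨hne.symm, hfC⟩))), fun g hg => ?_⟩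
    have h1 := (List.Nodup.mem_erase_iff (hnd.erase e)).mp hg
    have h2 := (List.Nodup.mem_erase_iff hnd).mp h1.2
    exact ((hC g h2.2).resolve_left h2.1).resolve_left h1.1
  rw [P.crossings_eq]
  by_cases hin : P.inside e
  · have hin' : ¬ P.inside f := fun h => hef ⟨fun _ => h, fun _ => hin⟩
    rw [P.even_crossings u v C D h.left h.right h.disjoint,
      P.linkingNumber_perm (List.Perm.refl _) hA]
    congr 1
    refine List.map_congr_left fun g hg => ?_
    rw [List.map_cons, List.sum_cons, List.map_cons, List.sum_cons,
      P.sum_overCrossings_eq_zero (hD g hg) hA']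
    simp [SpatialDiagram.overCrossings, hD g hg, he, hf, hin, hin']
  · have hin' : P.inside f := by tauto
    rw [P.linkingNumber_perm hA (List.Perm.refl _)]
    simp only [List.map_cons, List.sum_cons]
    have h1 : (A.map fun g => (D.edges.map fun h => P.overCrossings g h).sum).sum = 0 := by
      refine List.sum_eq_zero fun x hx => ?_
      obtain ⟨g, hg, rfl⟩ := List.mem_map.mp hx
      exact P.sum_overCrossings_eq_zero (hA' g hg) hD
    have h2 : (D.edges.map fun h => P.overCrossings f h).sum = 0 := by
      refine List.sum_eq_zero fun x hx => ?_
      obtain ⟨g, hg, rfl⟩ := List.mem_map.mp hx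
      simp [SpatialDiagram.overCrossings, hf, hD g hg, hin']
    rw [h1, h2, add_zero, add_zero]
    congr 1
    refine List.map_congr_left fun g hg => ?_
    simp [SpatialDiagram.overCrossings, he, hD g hg, hin]

theorem SpatialPlacement.linked_of_eq_one {P : SpatialPlacement G R} {e f : Sym2 V} {u v : V}
    {C : G.Walk u u} {D : G.Walk v v} (h : IsCyclePair C D)
    (hC : ∀ g ∈ C.edges, g = e ∨ g = f ∨ g ∈ M.edgeSet)
    (hD : ∀ g ∈ D.edges, g = e ∨ g = f ∨ g ∈ M.edgeSet) (hlk : P.linkingNumber C D = 1) :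
    P.Linked e f := by
  refine ⟨u, v, C, D, h.left, h.right, h.disjoint, fun g hg => ?_, fun g hg => ?_, hlk⟩
  · have := hC g hg
    simp only [Set.mem_union, Set.mem_insert_iff, Set.mem_singleton_iff]
    tauto
  · have := hD g hg
    simp only [Set.mem_union, Set.mem_insert_iff, Set.mem_singleton_iff]
    tauto

theorem ZMod.eq_one_or_of_add_eq_one {a b : ZMod 2} (h : a + b = 1) : a = 1 ∨ b = 1 := by
  revert a b
  decide

/-- Two fragments conflict strongly if two pairs of disjoint cycles pass through them such that the
two cycles through the first fragment together separate the ends of the second one: the two linking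
numbers cannot both be even. -/
theorem stronglyConflict_of_separates {e : Sym2 V} {p q : V} (he : e ∉ M.edgeSet)
    (hf : s(p, q) ∈ G.edgeSet \ M.edgeSet) {u₁ v₁ u₂ v₂ : V} {C₁ : G.Walk u₁ u₁} {D₁ : G.Walk v₁ v₁}
    {C₂ : G.Walk u₂ u₂} {D₂ : G.Walk v₂ v₂} (h₁ : IsCyclePair C₁ D₁) (h₂ : IsCyclePair C₂ D₂)
    (heC₁ : e ∈ C₁.edges) (hfD₁ : s(p, q) ∈ D₁.edges) (heC₂ : e ∈ C₂.edges)
    (hfD₂ : s(p, q) ∈ D₂.edges)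
    (hC₁ : ∀ g ∈ C₁.edges, g = e ∨ g ∈ M.edgeSet)
    (hD₁ : ∀ g ∈ D₁.edges, g = s(p, q) ∨ g ∈ M.edgeSet)
    (hC₂ : ∀ g ∈ C₂.edges, g = e ∨ g ∈ M.edgeSet)
    (hD₂ : ∀ g ∈ D₂.edges, g = s(p, q) ∨ g ∈ M.edgeSet) {z : Sym2 V → ZMod 2}
    (hz : open Classical in ∀ g ∈ M.edgeSet, z g = C₁.edges.count g + C₂.edges.count g)
    (hsep : R.toRotationSystem.Separates z p q) : StronglyConflict G R e s(p, q) := by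
  classical
  intro P hP
  have hl₁ := P.linkingNumber_of_same_side he hf.2 hP h₁ heC₁ hfD₁ hC₁ hD₁
  have hl₂ := P.linkingNumber_of_same_side he hf.2 hP h₂ heC₂ hfD₂ hC₂ hD₂
  have hsum : P.linkingNumber C₁ D₁ + P.linkingNumber C₂ D₂ = 1 := by
    rw [hl₁, hl₂, add_add_add_comm, CharTwo.add_self_eq_zero, zero_add,
      P.crossings_add _ _ _ (by convert hz)]
    exact (P.isShadow _ hf).sum_eq_one hsep
  rcases ZMod.eq_one_or_of_add_eq_one hsum with h | h
  · exact SpatialPlacement.linked_of_eq_one h₁ (fun g hg => by have := hC₁ g hg; tauto)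
      (fun g hg => by have := hD₁ g hg; tauto) h
  · exact SpatialPlacement.linked_of_eq_one h₂ (fun g hg => by have := hC₂ g hg; tauto)
      (fun g hg => by have := hD₂ g hg; tauto) h

/-- Two fragments anti-conflict strongly if there are two pairs of disjoint cycles such that the
first cycle of each pair passes through both fragments, the second cycles are in `M`, and together
they separate the ends of the first fragment. -/
theorem stronglyAntiConflict_of_separates {f : Sym2 V} {p q : V}
    (he : s(p, q) ∈ G.edgeSet \ M.edgeSet) (hf : f ∉ M.edgeSet) (hne : s(p, q) ≠ f)
    {u₁ v₁ u₂ v₂ : V} {C₁ : G.Walk u₁ u₁} {D₁ : G.Walk v₁ v₁}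
    {C₂ : G.Walk u₂ u₂} {D₂ : G.Walk v₂ v₂} (h₁ : IsCyclePair C₁ D₁) (h₂ : IsCyclePair C₂ D₂)
    (heC₁ : s(p, q) ∈ C₁.edges) (hfC₁ : f ∈ C₁.edges) (heC₂ : s(p, q) ∈ C₂.edges)
    (hfC₂ : f ∈ C₂.edges)
    (hC₁ : ∀ g ∈ C₁.edges, g = s(p, q) ∨ g = f ∨ g ∈ M.edgeSet)
    (hD₁ : ∀ g ∈ D₁.edges, g ∈ M.edgeSet)
    (hC₂ : ∀ g ∈ C₂.edges, g = s(p, q) ∨ g = f ∨ g ∈ M.edgeSet)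
    (hD₂ : ∀ g ∈ D₂.edges, g ∈ M.edgeSet) {z : Sym2 V → ZMod 2}
    (hz : open Classical in ∀ g ∈ M.edgeSet, z g = D₁.edges.count g + D₂.edges.count g)
    (hsep : R.toRotationSystem.Separates z p q) : StronglyAntiConflict G R s(p, q) f := by
  classical
  intro P hP
  have hl₁ := P.linkingNumber_of_opposite_sides he.2 hf hne hP h₁ heC₁ hfC₁ hC₁ hD₁
  have hl₂ := P.linkingNumber_of_opposite_sides he.2 hf hne hP h₂ heC₂ hfC₂ hC₂ hD₂
  have hsum : P.linkingNumber C₁ D₁ + P.linkingNumber C₂ D₂ = 1 := by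
    rw [hl₁, hl₂, P.crossings_add _ _ _ (by convert hz)]
    exact (P.isShadow _ he).sum_eq_one hsep
  rcases ZMod.eq_one_or_of_add_eq_one hsum with h | h
  · exact SpatialPlacement.linked_of_eq_one h₁ hC₁ (fun g hg => by have := hD₁ g hg; tauto) h
  · exact SpatialPlacement.linked_of_eq_one h₂ hC₂ (fun g hg => by have := hD₂ g hg; tauto) h

/-- The variant of `stronglyAntiConflict_of_separates` with a single pair of cycles. -/
theorem stronglyAntiConflict_of_separates_single {f : Sym2 V} {p q : V}
    (he : s(p, q) ∈ G.edgeSet \ M.edgeSet) (hf : f ∉ M.edgeSet) (hne : s(p, q) ≠ f)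
    {u v : V} {C : G.Walk u u} {D : G.Walk v v} (h : IsCyclePair C D)
    (heC : s(p, q) ∈ C.edges) (hfC : f ∈ C.edges)
    (hC : ∀ g ∈ C.edges, g = s(p, q) ∨ g = f ∨ g ∈ M.edgeSet)
    (hD : ∀ g ∈ D.edges, g ∈ M.edgeSet) {z : Sym2 V → ZMod 2}
    (hz : open Classical in ∀ g ∈ M.edgeSet, z g = D.edges.count g)
    (hsep : R.toRotationSystem.Separates z p q) : StronglyAntiConflict G R s(p, q) f := by
  classical
  intro P hP
  refine SpatialPlacement.linked_of_eq_one h hC (fun g hg => by have := hD g hg; tauto) ?_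
  have h0 := P.crossings_add s(p, q) D.edges [] (z := z) (by simpa using hz)
  rw [P.linkingNumber_of_opposite_sides he.2 hf hne hP h heC hfC hC hD]
  rw [(P.isShadow _ he).sum_eq_one hsep] at h0
  simpa [SpatialPlacement.crossings] using h0

end Linking

/-! ### Edge sets of `G₈` as bit masks -/

theorem isEvenChain_of_sum_eq_zero {V : Type*} [Fintype V] {M : SimpleGraph V}
    {z : Sym2 V → ZMod 2} (hz : ∀ u v, ¬ M.Adj u v → z s(u, v) = 0)
    (h : ∀ u, ∑ v, z s(u, v) = 0) : IsEvenChain M z := by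
  classical
  intro u
  refine Eq.trans ?_ (h u)
  rw [← Finset.sum_filter]
  refine Finset.sum_of_injOn (fun d : M.Dart => d.snd) ?_ (by simp) ?_ ?_
  · intro d hd d' hd' hdd
    have h1 : d.fst = u := by simpa using hd
    have h2 : d'.fst = u := by simpa using hd'
    exact SimpleGraph.Dart.ext _ _ (Prod.ext (h1.trans h2.symm) hdd)
  · intro v _ hv
    by_contra h0
    have huv : M.Adj u v := by
      by_contra h'
      exact h0 (hz u v h')
    exact hv ⟨⟨(u, v), huv⟩, by simp, rfl⟩
  · intro d hd
    have h1 : d.fst = u := by simpa using hd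
    rw [← h1]
    rfl

namespace G8Vertex

/-- The number of an edge of `G₈`, between 0 and 14, and 15 for a pair that is not an edge. -/
def edgeIndex : G8Vertex → G8Vertex → ℕ
  | some .v, some .a | some .a, some .v => 0
  | some .v, some .b | some .b, some .v => 1
  | some .v, some .x | some .x, some .v => 2
  | some .v, some .y | some .y, some .v => 3
  | some .v, none | none, some .v => 4
  | some .c, none | none, some .c => 5
  | some .z, none | none, some .z => 6
  | some .a, some .x | some .x, some .a => 7
  | some .a, some .y | some .y, some .a => 8
  | some .a, some .z | some .z, some .a => 9
  | some .b, some .x | some .x, some .b => 10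
  | some .b, some .y | some .y, some .b => 11
  | some .b, some .z | some .z, some .b => 12
  | some .c, some .x | some .x, some .c => 13
  | some .c, some .y | some .y, some .c => 14
  | _, _ => 15

/-- The edge with a given number. -/
def edgeOfIndex : ℕ → Sym2 G8Vertex
  | 0 => s(v, a)
  | 1 => s(v, b)
  | 2 => s(v, x)
  | 3 => s(v, y)
  | 4 => s(v, w)
  | 5 => s(c, w)
  | 6 => s(z, w)
  | 7 => s(a, x)
  | 8 => s(a, y)
  | 9 => s(a, z)
  | 10 => s(b, x)
  | 11 => s(b, y)
  | 12 => s(b, z)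
  | 13 => s(c, x)
  | _ => s(c, y)

/-- The list of all vertices. -/
def all : List G8Vertex := [v, a, b, c, x, y, z, w]

theorem mem_all (p : G8Vertex) : p ∈ all := by
  revert p
  decide

theorem toFinset_all : all.toFinset = Finset.univ := by decide

theorem nodup_all : all.Nodup := by decide

theorem sum_eq_sum_all (f : G8Vertex → ZMod 2) : ∑ p, f p = (all.map f).sum := by
  rw [← toFinset_all, List.sum_toFinset _ nodup_all]

theorem edgeIndex_comm (p q : G8Vertex) : edgeIndex p q = edgeIndex q p := by
  revert p q
  decide +kernel

theorem edgeOfIndex_edgeIndex {p q : G8Vertex} (h : edgeIndex p q < 15) :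
    edgeOfIndex (edgeIndex p q) = s(p, q) := by
  revert p q
  decide +kernel

theorem edgeIndex_le (p q : G8Vertex) : edgeIndex p q ≤ 15 := by
  revert p q
  decide +kernel

theorem eq_of_edgeIndex_eq {p q r t : G8Vertex} (h : edgeIndex p q = edgeIndex r t)
    (h' : edgeIndex p q < 15) : s(p, q) = s(r, t) := by
  rw [← edgeOfIndex_edgeIndex h', h, edgeOfIndex_edgeIndex (h ▸ h')]

theorem edgeIndex_eq_iff {p q r t : G8Vertex} (h : edgeIndex p q < 15) :
    edgeIndex p q = edgeIndex r t ↔ s(p, q) = s(r, t) := by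
  refine ⟨fun h' => eq_of_edgeIndex_eq h' h, fun h' => ?_⟩
  rcases Sym2.eq_iff.mp h' with ⟨rfl, rfl⟩ | ⟨rfl, rfl⟩
  · rfl
  · rw [edgeIndex_comm]

theorem adj_iff (p q : G8Vertex) : G8.Adj p q ↔ edgeIndex p q < 15 := by
  rcases p with _ | p <;> rcases q with _ | q
  · simp [edgeIndex]
  · cases q <;> simp [G8, deltaY, edgeIndex, SimpleGraph.map_adj']
  · cases p <;> simp [G8, deltaY, edgeIndex, SimpleGraph.map_adj']
  · cases p <;> cases q <;>
      simp [G8, deltaY, edgeIndex, SimpleGraph.map_adj', K331, K331Vertex.part]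

/-- The chain modulo 2 of the edges in the mask `m`, in which bit `i` stands for the edge of number
`i`. Bit 15, which would stand for the pairs that are not edges, is not set in the masks that are
used. -/
def maskChain (m : ℕ) : Sym2 G8Vertex → ZMod 2 :=
  Sym2.lift ⟨fun p q => if m.testBit (edgeIndex p q) then 1 else 0, fun p q => by
    simp only [edgeIndex_comm p q]⟩

theorem maskChain_mk (m : ℕ) (p q : G8Vertex) :
    maskChain m s(p, q) = if m.testBit (edgeIndex p q) then 1 else 0 := rfl

theorem maskChain_zero : maskChain 0 = 0 := by
  funext e
  induction e with
  | _ p q => simp [maskChain_mk]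

theorem maskChain_xor (m n : ℕ) : maskChain (m ^^^ n) = maskChain m + maskChain n := by
  funext e
  induction e with
  | _ p q =>
    simp only [Pi.add_apply, maskChain_mk, Nat.testBit_xor]
    cases m.testBit (edgeIndex p q) <;> cases n.testBit (edgeIndex p q) <;> decide

/-- The mask of the edges that are passed an odd number of times by the walk with the given
vertices. -/
def pathMask : List G8Vertex → ℕ
  | p :: q :: l => (1 <<< edgeIndex p q) ^^^ pathMask (q :: l)
  | _ => 0

/-- The mask of the edges of the closed walk with the given vertices. -/
def cycleMask : List G8Vertex → ℕ
  | [] => 0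
  | p :: l => pathMask (p :: l ++ [p])

/-- The edges of the mask `m` belong to the mask `k`. -/
def isSubmask (m k : ℕ) : Bool :=
  m &&& k == m

theorem testBit_of_isSubmask {m k i : ℕ} (h : isSubmask m k = true) (hi : m.testBit i = true) :
    k.testBit i = true := by
  simp only [isSubmask, beq_iff_eq] at h
  rw [← h, Nat.testBit_and, Bool.and_eq_true] at hi
  exact hi.2

/-- No edge of the mask `m` is incident with `p`. -/
def isOffMask (m : ℕ) (p : G8Vertex) : Bool :=
  all.all fun t => !m.testBit (edgeIndex p t)

/-- The mask `m` has an even number of edges at each vertex. -/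
def isEvenMask (m : ℕ) : Bool :=
  all.all fun p => !all.foldr (fun t s => m.testBit (edgeIndex p t) ^^ s) false

/-- The list describes a path with edges in `k`, and all vertices but the first one are off the
mask `m`. -/
def isPathOff (k m : ℕ) : List G8Vertex → Bool
  | p :: q :: l => k.testBit (edgeIndex p q) && isOffMask m q && isPathOff k m (q :: l)
  | _ => true

/-- The graph `M` contains the edges of the mask `k`. -/
def Contains (M : SimpleGraph G8Vertex) (k : ℕ) : Prop :=
  ∀ p q, k.testBit (edgeIndex p q) = true → M.Adj p q

section

variable {M : SimpleGraph G8Vertex} {k m : ℕ}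

theorem isOff_of_isOffMask {p : G8Vertex} (h : isOffMask m p = true) :
    RotationSystem.IsOff M (maskChain m) p := by
  intro q _
  have := List.all_eq_true.mp h q (mem_all q)
  rw [maskChain_mk, if_neg]
  simpa using this

theorem isEvenChain_of_isEvenMask (hM : Contains M k) (hm : isSubmask m k = true)
    (h : isEvenMask m = true) : IsEvenChain M (maskChain m) := by
  refine isEvenChain_of_sum_eq_zero (fun p q hpq => ?_) fun p => ?_
  · rw [maskChain_mk, if_neg]
    exact fun h' => hpq (hM p q (testBit_of_isSubmask hm h'))
  · have h1 := List.all_eq_true.mp h p (mem_all p)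
    have key : ∀ l : List G8Vertex, (l.map fun t => maskChain m s(p, t)).sum =
        if l.foldr (fun t s => m.testBit (edgeIndex p t) ^^ s) false then 1 else 0 := by
      intro l
      induction l with
      | nil => simp
      | cons t l ih =>
        rw [List.map_cons, List.sum_cons, ih, List.foldr_cons, maskChain_mk]
        cases m.testBit (edgeIndex p t) <;>
          cases l.foldr (fun t s => m.testBit (edgeIndex p t) ^^ s) false <;> decide
    rw [sum_eq_sum_all, key, if_neg]
    simpa using h1

theorem isPathOff_spec (hM : Contains M k) {p : G8Vertex} {l : List G8Vertex}
    (h : isPathOff k m (p :: l) = true) :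
    (p :: l).IsChain M.Adj ∧ ∀ q ∈ l, RotationSystem.IsOff M (maskChain m) q := by
  induction l generalizing p with
  | nil => simp
  | cons q l ih =>
    simp only [isPathOff, Bool.and_eq_true] at h
    obtain ⟨h1, h2⟩ := ih h.2
    refine ⟨List.isChain_cons_cons.mpr ⟨hM _ _ h.1.1, h1⟩, fun r hr => ?_⟩
    rcases List.mem_cons.mp hr with rfl | hr
    · exact isOff_of_isOffMask h.1.2
    · exact h2 r hr

end

/-! ### Claws -/

/-- The data for an application of the claw rule: a vertex, three closed walks, and three paths that
start at the vertex (which is not listed), the `i`-th path being off the `i`-th closed walk, while the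
other two closed walks pass at the vertex through the first edge of the path. -/
structure Claw where
  /-- the vertex -/
  o : G8Vertex
  /-- the first closed walk -/
  z₁ : List G8Vertex
  /-- the second closed walk -/
  z₂ : List G8Vertex
  /-- the third closed walk -/
  z₃ : List G8Vertex
  /-- the first path -/
  l₁ : List G8Vertex
  /-- the second path -/
  l₂ : List G8Vertex
  /-- the third path -/
  l₃ : List G8Vertex

namespace Claw

/-- The image of a claw under a map of the vertices. -/
def map (σ : G8Vertex → G8Vertex) (C : Claw) : Claw :=
  ⟨σ C.o, C.z₁.map σ, C.z₂.map σ, C.z₃.map σ, C.l₁.map σ, C.l₂.map σ, C.l₃.map σ⟩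

/-- The sum of the three closed walks. -/
def total (C : Claw) : ℕ :=
  cycleMask C.z₁ ^^^ cycleMask C.z₂ ^^^ cycleMask C.z₃

/-- The claw rule applies to the claw in each graph with the edges of the mask `k`. -/
def isValid (k : ℕ) (C : Claw) : Bool :=
  match C.l₁, C.l₂, C.l₃ with
  | a :: l₁, b :: l₂, c :: l₃ =>
    a != b && b != c && a != c &&
    isSubmask (cycleMask C.z₁) k && isSubmask (cycleMask C.z₂) k && isSubmask (cycleMask C.z₃) k &&
    isEvenMask (cycleMask C.z₁) && isEvenMask (cycleMask C.z₂) && isEvenMask (cycleMask C.z₃) &&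
    all.all (fun t => (cycleMask C.z₂).testBit (edgeIndex C.o t) == (t == a || t == c)) &&
    all.all (fun t => (cycleMask C.z₃).testBit (edgeIndex C.o t) == (t == a || t == b)) &&
    isPathOff k (cycleMask C.z₁) (C.o :: a :: l₁) &&
    isPathOff k (cycleMask C.z₂) (C.o :: b :: l₂) &&
    isPathOff k (cycleMask C.z₃) (C.o :: c :: l₃)
  | _, _, _ => false

/-- The claw rule, with the colours transported along the paths to their ends. The first path starts
with the edge `o a`, whose colour for the first walk is included in the sum on the right. -/
theorem colour_add_colour {C : Claw} {k : ℕ} (hC : C.isValid k = true)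
    {M : SimpleGraph G8Vertex} (hM : Contains M k) {R : RotationSystem M}
    {f₁ f₂ f₃ : R.Face → ZMod 2} (h₁ : R.Cobounds f₁ (maskChain (cycleMask C.z₁)))
    (h₂ : R.Cobounds f₂ (maskChain (cycleMask C.z₂)))
    (h₃ : R.Cobounds f₃ (maskChain (cycleMask C.z₃))) :
    ∃ a, M.Adj C.o a ∧ ∀ q₁ q₂ q₃ t₁ t₂ t₃, C.l₁.getLast? = some q₁ → C.l₂.getLast? = some q₂ →
      C.l₃.getLast? = some q₃ → M.Adj q₁ t₁ → M.Adj q₂ t₂ → M.Adj q₃ t₃ →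
      R.colour f₁ q₁ t₁ + R.colour f₂ q₂ t₂ + R.colour f₃ q₃ t₃ =
        1 + R.colour (f₁ + f₂ + f₃) C.o a := by
  obtain ⟨o, z₁, z₂, z₃, l₁, l₂, l₃⟩ := C
  rcases l₁ with _ | ⟨a, l₁⟩
  · simp [isValid] at hC
  rcases l₂ with _ | ⟨b, l₂⟩
  · simp [isValid] at hC
  rcases l₃ with _ | ⟨c, l₃⟩
  · simp [isValid] at hC
  simp only [isValid, Bool.and_eq_true, bne_iff_ne] at hC
  obtain ⟨⟨⟨⟨⟨⟨⟨⟨⟨⟨⟨⟨⟨hab, hbc⟩, hac⟩, -⟩, -⟩, -⟩, -⟩, -⟩, -⟩, hz₂⟩, hz₃⟩, hp₁⟩, hp₂⟩, hp₃⟩ := hC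
  obtain ⟨hc₁, ho₁⟩ := isPathOff_spec hM hp₁
  obtain ⟨hc₂, ho₂⟩ := isPathOff_spec hM hp₂
  obtain ⟨hc₃, ho₃⟩ := isPathOff_spec hM hp₃
  have ha := (List.isChain_cons_cons.mp hc₁).1
  have hb := (List.isChain_cons_cons.mp hc₂).1
  have hc := (List.isChain_cons_cons.mp hc₃).1
  refine ⟨a, ha, fun q₁ q₂ q₃ t₁ t₂ t₃ hq₁ hq₂ hq₃ ht₁ ht₂ ht₃ => ?_⟩
  rw [h₁.colour_eq_of_path hc₁ ho₁ hq₁ ht₁, h₂.colour_eq_of_path hc₂ ho₂ hq₂ ht₂,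
    h₃.colour_eq_of_path hc₃ ho₃ hq₃ ht₃, add_assoc, RotationSystem.claw h₂ h₃ ha hb hc hab hbc hac,
    RotationSystem.colour_add, RotationSystem.colour_add, RotationSystem.colour_add]
  · ring
  · intro t _
    have h := List.all_eq_true.mp hz₂ t (mem_all t)
    rw [beq_iff_eq] at h
    rw [maskChain_mk, h]
    simp
  · intro t _
    have h := List.all_eq_true.mp hz₃ t (mem_all t)
    rw [beq_iff_eq] at h
    rw [maskChain_mk, h]
    simp

theorem exists_cobounds {C : Claw} {k : ℕ} (hC : C.isValid k = true)
    {M : SimpleGraph G8Vertex} (hM : Contains M k) (R : PlanarEmbedding M) :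
    (∃ f, R.toRotationSystem.Cobounds f (maskChain (cycleMask C.z₁))) ∧
    (∃ f, R.toRotationSystem.Cobounds f (maskChain (cycleMask C.z₂))) ∧
    ∃ f, R.toRotationSystem.Cobounds f (maskChain (cycleMask C.z₃)) := by
  obtain ⟨o, z₁, z₂, z₃, l₁, l₂, l₃⟩ := C
  rcases l₁ with _ | ⟨a, l₁⟩
  · simp [isValid] at hC
  rcases l₂ with _ | ⟨b, l₂⟩
  · simp [isValid] at hC
  rcases l₃ with _ | ⟨c, l₃⟩
  · simp [isValid] at hC
  simp only [isValid, Bool.and_eq_true] at hC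
  obtain ⟨⟨⟨⟨⟨⟨⟨⟨⟨⟨⟨-, hs₁⟩, hs₂⟩, hs₃⟩, he₁⟩, he₂⟩, he₃⟩, -⟩, -⟩, -⟩, -⟩, -⟩ := hC
  exact ⟨R.exists_cobounds (isEvenChain_of_isEvenMask hM hs₁ he₁),
    R.exists_cobounds (isEvenChain_of_isEvenMask hM hs₂ he₂),
    R.exists_cobounds (isEvenChain_of_isEvenMask hM hs₃ he₃)⟩

/-- All three paths of the claw end at `q`. -/
def endsAt (C : Claw) (q : G8Vertex) : Bool :=
  C.l₁.getLast? == some q && C.l₂.getLast? == some q && C.l₃.getLast? == some q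

theorem exists_colour_of_endsAt {C : Claw} {k : ℕ} {q : G8Vertex}
    (hC : C.isValid k = true) (hq : C.endsAt q = true)
    {M : SimpleGraph G8Vertex} (hM : Contains M k) (R : PlanarEmbedding M) :
    ∃ f, R.toRotationSystem.Cobounds f (maskChain C.total) ∧ ∃ a, M.Adj C.o a ∧
      ∀ t, M.Adj q t → R.toRotationSystem.colour f q t =
        1 + R.toRotationSystem.colour f C.o a := by
  obtain ⟨⟨f₁, h₁⟩, ⟨f₂, h₂⟩, f₃, h₃⟩ := exists_cobounds hC hM R
  simp only [endsAt, Bool.and_eq_true, beq_iff_eq] at hq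
  refine ⟨f₁ + f₂ + f₃, ?_, ?_⟩
  · rw [total, maskChain_xor, maskChain_xor]
    exact (h₁.add h₂).add h₃
  · obtain ⟨a, ha, h⟩ := colour_add_colour hC hM h₁ h₂ h₃
    refine ⟨a, ha, fun t ht => ?_⟩
    rw [← h q q q t t t hq.1.1 hq.1.2 hq.2 ht ht ht, RotationSystem.colour_add,
      RotationSystem.colour_add]

/-- The claw shows that each graph with the edges of the mask `k` is nonplanar: its paths have the
same end, and the path `l` leads there off the sum of the closed walks. -/
def isObstruction (k : ℕ) (C : Claw) (l : List G8Vertex) : Bool :=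
  match l.getLast? with
  | none => false
  | some q => C.isValid k && C.endsAt q && isOffMask C.total C.o &&
      isPathOff k C.total (C.o :: l)

theorem not_isPlanar {C : Claw} {k : ℕ} {l : List G8Vertex}
    (h : C.isObstruction k l = true) {M : SimpleGraph G8Vertex} (hM : Contains M k) :
    ¬ IsPlanar M := by
  rintro ⟨R⟩
  rcases l with _ | ⟨r, l⟩
  · simp [isObstruction] at h
  obtain ⟨q, hq⟩ : ∃ q, (r :: l).getLast? = some q := ⟨_, List.getLast?_eq_some_getLast (by simp)⟩
  simp only [isObstruction, hq, Bool.and_eq_true] at h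
  obtain ⟨⟨⟨hC, hq'⟩, ho⟩, hl⟩ := h
  obtain ⟨f, hf, a, ha, hfq⟩ := exists_colour_of_endsAt hC hq' hM R
  obtain ⟨hch, hoff⟩ := isPathOff_spec hM hl
  have hor := (List.isChain_cons_cons.mp hch).1
  -- `q` is the end of a path, so it has a neighbour
  obtain ⟨t, ht⟩ : ∃ t, M.Adj q t := by
    have hmem : q ∈ r :: l := List.mem_of_getLast? hq
    obtain ⟨i, hi, rfl⟩ := List.mem_iff_getElem.mp hmem
    exact ⟨_, (List.isChain_iff_getElem.mp hch i (by simpa using hi)).symm⟩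
  have h1 := hf.colour_eq_of_path hch hoff hq ht
  rw [hf.colour_eq_of_isOff (isOff_of_isOffMask ho) hor ha, hfq t ht] at h1
  simp at h1

/-- The claw shows that the cycle `m` separates `p` and `q` in each embedding of a graph with the
edges of the mask `k`: either it is based at one of the two vertices and ends at the other one, or
it consists of the three cycles of a theta graph, the third one being `m`, two paths to `q` and one
path to `p`. -/
def isSeparation (k m : ℕ) (C : Claw) (p q : G8Vertex) : Bool :=
  C.isValid k &&
    ((C.total == m && C.o == p && isOffMask m p && C.endsAt q) ||
      (C.total == 0 && cycleMask C.z₃ == m && C.l₁.getLast? == some q &&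
        C.l₂.getLast? == some q && C.l₃.getLast? == some p))

theorem separates {C : Claw} {k m : ℕ} {p q : G8Vertex} (h : C.isSeparation k m p q = true)
    {M : SimpleGraph G8Vertex} (hM : Contains M k) (R : PlanarEmbedding M) :
    R.toRotationSystem.Separates (maskChain m) p q := by
  simp only [isSeparation, Bool.and_eq_true, Bool.or_eq_true, beq_iff_eq] at h
  obtain ⟨hC, h⟩ := h
  rcases h with ⟨⟨⟨rfl, rfl⟩, ho⟩, hq⟩ | ⟨⟨⟨⟨h0, rfl⟩, hq₁⟩, hq₂⟩, hp⟩
  · obtain ⟨f, hf, a, ha, h⟩ := exists_colour_of_endsAt hC hq hM R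
    refine ⟨f, hf, ?_⟩
    rintro d d' hd rfl
    have h1 := h _ d'.adj
    have h2 : M.Adj C.o d.snd := hd ▸ d.adj
    rw [RotationSystem.colour_fst_snd, hf.colour_eq_of_isOff (isOff_of_isOffMask ho) ha h2, ← hd,
      RotationSystem.colour_fst_snd] at h1
    rw [h1, add_comm, add_assoc, CharTwo.add_self_eq_zero, add_zero]
  · obtain ⟨⟨f₁, h₁⟩, ⟨f₂, h₂⟩, -⟩ := exists_cobounds hC hM R
    have h₃ : R.toRotationSystem.Cobounds (f₁ + f₂) (maskChain (cycleMask C.z₃)) := by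
      have e : cycleMask C.z₃ = cycleMask C.z₁ ^^^ cycleMask C.z₂ :=
        (Nat.xor_eq_zero_iff.mp h0).symm
      rw [e, maskChain_xor]
      exact h₁.add h₂
    refine ⟨_, h₃, ?_⟩
    rintro d d' rfl rfl
    obtain ⟨a, -, h⟩ := colour_add_colour hC hM h₁ h₂ h₃
    have h1 := h _ _ _ _ _ _ hq₁ hq₂ hp d'.adj d'.adj d.adj
    rw [RotationSystem.colour_fst_snd, RotationSystem.colour_fst_snd,
      RotationSystem.colour_fst_snd] at h1
    have h2 : f₁ + f₂ + (f₁ + f₂) = 0 := funext fun F => CharTwo.add_self_eq_zero ((f₁ + f₂) F)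
    have h4 : R.toRotationSystem.colour (0 : R.toRotationSystem.Face → ZMod 2) C.o a = 0 := by
      simp [RotationSystem.colour]
    rw [h2, h4, add_zero] at h1
    rw [← h1, add_comm]
    rfl

end Claw

end G8Vertex

/-! ### Cycles of `G₈` and signed edges of the strong conflict graph -/

namespace G8Vertex

theorem maskChain_one_shiftLeft {p q : G8Vertex} (h : G8.Adj p q) (e : Sym2 G8Vertex) :
    maskChain (1 <<< edgeIndex p q) e = if s(p, q) = e then 1 else 0 := by
  induction e with
  | _ r t =>
    rw [maskChain_mk, Nat.one_shiftLeft, Nat.testBit_two_pow]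
    simp only [decide_eq_true_eq, edgeIndex_eq_iff ((adj_iff p q).mp h)]

theorem maskChain_pathMask {p q : G8Vertex} (W : G8.Walk p q) (e : Sym2 G8Vertex) :
    maskChain (pathMask W.support) e = W.edges.count e := by
  induction W with
  | nil => simp [pathMask, maskChain_zero]
  | @cons p r q h W ih =>
    rw [SimpleGraph.Walk.support_cons, SimpleGraph.Walk.edges_cons, List.count_cons, Nat.cast_add,
      ← ih, ← W.cons_tail_support, pathMask, maskChain_xor, Pi.add_apply, maskChain_one_shiftLeft h,
      add_comm]
    simp

theorem exists_walk_of_isChain {V : Type*} {G : SimpleGraph V} {r t : V} {l : List V}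
    (h : (r :: l).IsChain G.Adj) (ht : (r :: l).getLast? = some t) :
    ∃ W : G.Walk r t, W.support = r :: l := by
  induction l generalizing r with
  | nil =>
    obtain rfl : r = t := by simpa using ht
    exact ⟨SimpleGraph.Walk.nil, rfl⟩
  | cons q l ih =>
    rw [List.isChain_cons_cons] at h
    obtain ⟨W, hW⟩ := ih h.2 (by simpa using ht)
    exact ⟨SimpleGraph.Walk.cons h.1 W, by rw [SimpleGraph.Walk.support_cons, hW]⟩

/-- The list describes a cycle of `G₈`, the mask of which is `2 ^ 15 - 1 = 32767`. -/
def isCycleList : List G8Vertex → Bool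
  | p :: q :: l => isPathOff 32767 0 (p :: q :: l ++ [p]) && decide (q :: l ++ [p]).Nodup &&
      !(pathMask (q :: l ++ [p])).testBit (edgeIndex p q)
  | _ => false

theorem contains_G8 : Contains G8 32767 := by
  intro p q h
  rw [adj_iff]
  revert p q
  decide +kernel

theorem exists_isCycle {l : List G8Vertex} (h : isCycleList l = true) :
    ∃ (p : G8Vertex) (C : G8.Walk p p), C.IsCycle ∧ (∀ r ∈ C.support, r ∈ l) ∧
      ∀ e, maskChain (cycleMask l) e = C.edges.count e := by
  rcases l with _ | ⟨p, _ | ⟨q, l⟩⟩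
  · simp [isCycleList] at h
  · simp [isCycleList] at h
  simp only [isCycleList, Bool.and_eq_true, decide_eq_true_eq, Bool.not_eq_true'] at h
  obtain ⟨⟨hch, hnd⟩, hpq⟩ := h
  have hch := (isPathOff_spec contains_G8 hch).1
  have hadj : G8.Adj p q := (List.isChain_cons_cons.mp hch).1
  have hch' : (q :: l ++ [p]).IsChain G8.Adj := (List.isChain_cons_cons.mp hch).2
  obtain ⟨W, hW⟩ : ∃ W : G8.Walk q p, W.support = q :: l ++ [p] :=
    exists_walk_of_isChain hch' (List.getLast?_concat (l := q :: l))
  have hpath : W.IsPath := (SimpleGraph.Walk.isPath_def W).mpr (hW ▸ hnd)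
  have hmem : s(p, q) ∉ W.edges := by
    intro hmem
    have h1 := maskChain_pathMask W s(p, q)
    rw [List.count_eq_one_of_mem hpath.isTrail.edges_nodup hmem, hW, maskChain_mk, hpq] at h1
    simp at h1
  refine ⟨p, SimpleGraph.Walk.cons hadj W, (SimpleGraph.Walk.cons_isCycle_iff W hadj).mpr
    ⟨hpath, hmem⟩, ?_, fun e => ?_⟩
  · intro r hr
    rw [SimpleGraph.Walk.support_cons, hW] at hr
    simp only [List.cons_append, List.mem_cons, List.mem_append] at hr ⊢
    tauto
  · rw [← maskChain_pathMask, SimpleGraph.Walk.support_cons, hW]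
    rfl

/-- The mask of a single edge. -/
def edgeMask (e : G8Vertex × G8Vertex) : ℕ :=
  1 <<< edgeIndex e.1 e.2

theorem mem_edges_iff {p : G8Vertex} {C : G8.Walk p p} (hC : C.IsCycle) {m : ℕ}
    (hm : ∀ e, maskChain m e = C.edges.count e) (r t : G8Vertex) :
    s(r, t) ∈ C.edges ↔ m.testBit (edgeIndex r t) = true := by
  have h := hm s(r, t)
  rw [maskChain_mk] at h
  constructor
  · intro hmem
    rw [List.count_eq_one_of_mem hC.edges_nodup hmem] at h
    by_contra h'
    simp [h'] at h
  · intro hbit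
    by_contra hmem
    rw [List.count_eq_zero_of_not_mem hmem, if_pos hbit] at h
    simp at h

/-- The lists describe two disjoint cycles of `G₈`. -/
def isCyclePairList (C D : List G8Vertex) : Bool :=
  isCycleList C && isCycleList D && C.all fun p => !D.contains p

theorem exists_isCyclePair {C D : List G8Vertex} (h : isCyclePairList C D = true) :
    ∃ (p q : G8Vertex) (C' : G8.Walk p p) (D' : G8.Walk q q), IsCyclePair C' D' ∧
      (∀ e, maskChain (cycleMask C) e = C'.edges.count e) ∧
      ∀ e, maskChain (cycleMask D) e = D'.edges.count e := by
  simp only [isCyclePairList, Bool.and_eq_true] at h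
  obtain ⟨⟨hC, hD⟩, h⟩ := h
  obtain ⟨p, C', hC', hC₁, hC₂⟩ := exists_isCycle hC
  obtain ⟨q, D', hD', hD₁, hD₂⟩ := exists_isCycle hD
  refine ⟨p, q, C', D', ⟨hC', hD', fun r hr hr' => ?_⟩, hC₂, hD₂⟩
  have := List.all_eq_true.mp h r (hC₁ r hr)
  simp [hD₁ r hr'] at this

/-- The data of a signed edge of the strong conflict graph: two fragments, one or two pairs of
disjoint cycles, and a claw that shows that the ends of the second fragment are separated. -/
structure SignedEdgeData where
  /-- the sign: `true` for a strong conflict, `false` for a strong anti-conflict -/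
  conflict : Bool
  /-- the first fragment -/
  e : G8Vertex × G8Vertex
  /-- the second fragment -/
  f : G8Vertex × G8Vertex
  /-- the first cycle of the first pair -/
  C₁ : List G8Vertex
  /-- the second cycle of the first pair -/
  D₁ : List G8Vertex
  /-- the first cycle of the second pair; empty if there is only one pair -/
  C₂ : List G8Vertex
  /-- the second cycle of the second pair; empty if there is only one pair -/
  D₂ : List G8Vertex
  /-- the claw -/
  claw : Claw

namespace SignedEdgeData

/-- The image of the data under a map of the vertices. -/
def map (σ : G8Vertex → G8Vertex) (A : SignedEdgeData) : SignedEdgeData :=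
  ⟨A.conflict, (σ A.e.1, σ A.e.2), (σ A.f.1, σ A.f.2), A.C₁.map σ, A.D₁.map σ, A.C₂.map σ,
    A.D₂.map σ, A.claw.map σ⟩

/-- The sign of the edge. -/
def sign (A : SignedEdgeData) : ℤˣ :=
  bif A.conflict then -1 else 1

/-- The cycle passes through the edge, and all its other edges are in `k`. -/
def passes (k : ℕ) (C : List G8Vertex) (e : G8Vertex × G8Vertex) : Bool :=
  (cycleMask C).testBit (edgeIndex e.1 e.2) && isSubmask (cycleMask C) (k ||| edgeMask e)

/-- The data show that the two fragments are joined, in each embedding of the subgraph of `G₈` with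
the mask `k`. -/
def isValid (k : ℕ) (A : SignedEdgeData) : Bool :=
  decide (edgeIndex A.e.1 A.e.2 < 15) && decide (edgeIndex A.f.1 A.f.2 < 15) &&
  !k.testBit (edgeIndex A.e.1 A.e.2) && !k.testBit (edgeIndex A.f.1 A.f.2) &&
  edgeIndex A.e.1 A.e.2 != edgeIndex A.f.1 A.f.2 &&
  isCyclePairList A.C₁ A.D₁ &&
  bif A.conflict then
    isCyclePairList A.C₂ A.D₂ && passes k A.C₁ A.e && passes k A.D₁ A.f && passes k A.C₂ A.e &&
    passes k A.D₂ A.f &&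
    A.claw.isSeparation k (cycleMask A.C₁ ^^^ cycleMask A.C₂) A.f.1 A.f.2
  else
    passes (k ||| edgeMask A.e) A.C₁ A.f && passes (k ||| edgeMask A.f) A.C₁ A.e &&
    isSubmask (cycleMask A.D₁) k &&
    ((A.C₂.isEmpty && A.claw.isSeparation k (cycleMask A.D₁) A.f.1 A.f.2) ||
      (isCyclePairList A.C₂ A.D₂ && passes (k ||| edgeMask A.e) A.C₂ A.f &&
        passes (k ||| edgeMask A.f) A.C₂ A.e && isSubmask (cycleMask A.D₂) k &&
        A.claw.isSeparation k (cycleMask A.D₁ ^^^ cycleMask A.D₂) A.f.1 A.f.2))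

end SignedEdgeData

/-- Two fragments are joined by an edge of the given sign in the strong conflict graph. -/
def Joined {M : SimpleGraph G8Vertex} (R : PlanarEmbedding M) (e f : Sym2 G8Vertex) (s : ℤˣ) :
    Prop :=
  ∃ (he : e ∈ G8.edgeSet \ M.edgeSet) (hf : f ∈ G8.edgeSet \ M.edgeSet),
    (strongConflictGraph G8 R).Edge ⟨e, he⟩ ⟨f, hf⟩ s

/-- The mask `k` is the set of edges of `M`. -/
def IsMaskOf (M : SimpleGraph G8Vertex) (k : ℕ) : Prop :=
  ∀ p q, M.Adj p q ↔ k.testBit (edgeIndex p q) = true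

section

variable {M : SimpleGraph G8Vertex} {k : ℕ}

theorem testBit_edgeMask {e : G8Vertex × G8Vertex} (he : edgeIndex e.1 e.2 < 15) {r t : G8Vertex}
    (h : (edgeMask e).testBit (edgeIndex r t) = true) : s(r, t) = s(e.1, e.2) := by
  rw [edgeMask, Nat.one_shiftLeft, Nat.testBit_two_pow, decide_eq_true_eq] at h
  exact (eq_of_edgeIndex_eq h he).symm

theorem eq_or_mem_of_isSubmask {p : G8Vertex} {C : G8.Walk p p} (hC : C.IsCycle) {m k' : ℕ}
    (hm : ∀ e, maskChain m e = C.edges.count e) (h : isSubmask m k' = true) (g : Sym2 G8Vertex)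
    (hg : g ∈ C.edges) : ∃ r t, g = s(r, t) ∧ k'.testBit (edgeIndex r t) = true := by
  induction g with
  | _ r t => exact ⟨r, t, rfl, testBit_of_isSubmask h ((mem_edges_iff hC hm r t).mp hg)⟩

theorem mem_of_passes (hM : IsMaskOf M k) {p : G8Vertex} {l : List G8Vertex} {C : G8.Walk p p}
    (hC : C.IsCycle) (hm : ∀ e, maskChain (cycleMask l) e = C.edges.count e)
    {e : G8Vertex × G8Vertex} (he : edgeIndex e.1 e.2 < 15)
    (h : SignedEdgeData.passes k l e = true) :
    s(e.1, e.2) ∈ C.edges ∧ ∀ g ∈ C.edges, g = s(e.1, e.2) ∨ g ∈ M.edgeSet := by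
  simp only [SignedEdgeData.passes, Bool.and_eq_true] at h
  refine ⟨(mem_edges_iff hC hm _ _).mpr h.1, fun g hg => ?_⟩
  obtain ⟨r, t, rfl, hrt⟩ := eq_or_mem_of_isSubmask hC hm h.2 g hg
  rw [Nat.testBit_or, Bool.or_eq_true] at hrt
  rcases hrt with hrt | hrt
  · exact Or.inr ((hM r t).mpr hrt)
  · exact Or.inl (testBit_edgeMask he hrt)

theorem mem_of_passes_both (hM : IsMaskOf M k) {p : G8Vertex} {l : List G8Vertex}
    {C : G8.Walk p p} (hC : C.IsCycle) (hm : ∀ e, maskChain (cycleMask l) e = C.edges.count e)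
    {e f : G8Vertex × G8Vertex} (he : edgeIndex e.1 e.2 < 15) (hf : edgeIndex f.1 f.2 < 15)
    (h : SignedEdgeData.passes (k ||| edgeMask e) l f = true)
    (h' : SignedEdgeData.passes (k ||| edgeMask f) l e = true) :
    s(f.1, f.2) ∈ C.edges ∧ s(e.1, e.2) ∈ C.edges ∧
      ∀ g ∈ C.edges, g = s(f.1, f.2) ∨ g = s(e.1, e.2) ∨ g ∈ M.edgeSet := by
  simp only [SignedEdgeData.passes, Bool.and_eq_true] at h h'
  refine ⟨(mem_edges_iff hC hm _ _).mpr h.1, (mem_edges_iff hC hm _ _).mpr h'.1, fun g hg => ?_⟩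
  obtain ⟨r, t, rfl, hrt⟩ := eq_or_mem_of_isSubmask hC hm h.2 g hg
  rw [Nat.testBit_or, Nat.testBit_or, Bool.or_eq_true, Bool.or_eq_true] at hrt
  rcases hrt with (hrt | hrt) | hrt
  · exact Or.inr (Or.inr ((hM r t).mpr hrt))
  · exact Or.inr (Or.inl (testBit_edgeMask he hrt))
  · exact Or.inl (testBit_edgeMask hf hrt)

theorem mem_of_isSubmask (hM : IsMaskOf M k) {p : G8Vertex} {l : List G8Vertex} {C : G8.Walk p p}
    (hC : C.IsCycle) (hm : ∀ e, maskChain (cycleMask l) e = C.edges.count e)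
    (h : isSubmask (cycleMask l) k = true) : ∀ g ∈ C.edges, g ∈ M.edgeSet := by
  intro g hg
  obtain ⟨r, t, rfl, hrt⟩ := eq_or_mem_of_isSubmask hC hm h g hg
  exact (hM r t).mpr hrt

theorem SignedEdgeData.joined {A : SignedEdgeData} (h : A.isValid k = true) (hM : IsMaskOf M k)
    (R : PlanarEmbedding M) : Joined R s(A.e.1, A.e.2) s(A.f.1, A.f.2) A.sign := by
  classical
  obtain ⟨con, e, ⟨f₁, f₂⟩, lC₁, lD₁, lC₂, lD₂, claw⟩ := A
  have hcont : Contains M k := fun p q => (hM p q).mpr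
  simp only [isValid, Bool.and_eq_true, decide_eq_true_eq, Bool.not_eq_true', bne_iff_ne] at h
  obtain ⟨⟨⟨⟨⟨⟨he, hf⟩, hek⟩, hfk⟩, hne⟩, hp₁⟩, h⟩ := h
  have he' : s(e.1, e.2) ∈ G8.edgeSet \ M.edgeSet :=
    ⟨(adj_iff _ _).mpr he, fun h => by
      have := (hM _ _).mp h
      simp [hek] at this⟩
  have hf' : s(f₁, f₂) ∈ G8.edgeSet \ M.edgeSet :=
    ⟨(adj_iff _ _).mpr hf, fun h => by
      have := (hM _ _).mp h
      simp [hfk] at this⟩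
  have hne' : s(e.1, e.2) ≠ s(f₁, f₂) := fun h => hne ((edgeIndex_eq_iff he).mpr h)
  refine ⟨he', hf', fun h => hne' (congrArg Subtype.val h), ?_⟩
  obtain ⟨u₁, v₁, C₁, D₁, hCD₁, hC₁, hD₁⟩ := exists_isCyclePair hp₁
  cases con with
  | true =>
    refine Or.inl ⟨rfl, ?_⟩
    simp only [cond_true, Bool.and_eq_true] at h
    obtain ⟨⟨⟨⟨⟨hp₂, h₁⟩, h₂⟩, h₃⟩, h₄⟩, hsep⟩ := h
    obtain ⟨u₂, v₂, C₂, D₂, hCD₂, hC₂, hD₂⟩ := exists_isCyclePair hp₂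
    have m₁ := mem_of_passes hM hCD₁.left hC₁ he h₁
    have m₂ := mem_of_passes hM hCD₁.right hD₁ hf h₂
    have m₃ := mem_of_passes hM hCD₂.left hC₂ he h₃
    have m₄ := mem_of_passes hM hCD₂.right hD₂ hf h₄
    refine stronglyConflict_of_separates he'.2 hf' hCD₁ hCD₂ m₁.1 m₂.1 m₃.1 m₄.1 m₁.2 m₂.2 m₃.2
      m₄.2 (fun g _ => ?_) (Claw.separates hsep hcont R)
    rw [maskChain_xor, Pi.add_apply, hC₁, hC₂]
    congr!
  | false =>
    refine Or.inr ⟨rfl, ?_⟩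
    suffices hanti : StronglyAntiConflict G8 R s(f₁, f₂) s(e.1, e.2) from
      fun P hP => (hanti P fun h => hP h.symm).symm
    simp only [cond_false, Bool.and_eq_true, Bool.or_eq_true] at h
    obtain ⟨⟨⟨h₁, h₂⟩, h₃⟩, h⟩ := h
    have m₁ := mem_of_passes_both hM hCD₁.left hC₁ he hf h₁ h₂
    have m₂ := mem_of_isSubmask hM hCD₁.right hD₁ h₃
    rcases h with ⟨-, hsep⟩ | ⟨⟨⟨⟨hp₂, h₄⟩, h₅⟩, h₆⟩, hsep⟩
    · refine stronglyAntiConflict_of_separates_single hf' he'.2 hne'.symm hCD₁ m₁.1 m₁.2.1 m₁.2.2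
        m₂ (fun g _ => ?_) (Claw.separates hsep hcont R)
      rw [hD₁]
      congr!
    · obtain ⟨u₂, v₂, C₂, D₂, hCD₂, hC₂, hD₂⟩ := exists_isCyclePair hp₂
      have m₃ := mem_of_passes_both hM hCD₂.left hC₂ he hf h₄ h₅
      have m₄ := mem_of_isSubmask hM hCD₂.right hD₂ h₆
      refine stronglyAntiConflict_of_separates hf' he'.2 hne'.symm hCD₁ hCD₂ m₁.1 m₁.2.1 m₃.1
        m₃.2.1 m₁.2.2 m₂ m₃.2.2 m₄ (fun g _ => ?_) (Claw.separates hsep hcont R)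
      rw [maskChain_xor, Pi.add_apply, hD₁, hD₂]
      congr!

end

end G8Vertex

/-! ### Planar subgraphs of `G₈`, given by their faces -/

namespace G8Vertex

/-- The vertex that follows the first occurrence of `p`, `q` in the list. -/
def third? (p q : G8Vertex) : List G8Vertex → Option G8Vertex
  | r :: s :: t :: l => if r == p && s == q then some t else third? p q (s :: t :: l)
  | _ => none

/-- The vertex that follows `p`, `q` on the boundary of a face. The first two vertices of each closed
walk are repeated at its end, so that all its consecutive triples are found. -/
def next (F : List (List G8Vertex)) (p q : G8Vertex) : G8Vertex :=
  (F.findSome? fun l => third? p q (l ++ l.take 2)).getD p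

/-- The number of the face that is on one side of the edge from `p` to `q`. -/
def faceIndex (F : List (List G8Vertex)) (p q : G8Vertex) : ℕ :=
  F.findIdx fun l => (third? p q (l ++ l.take 2)).isSome

/-- The closed walks in the list `F` are the faces of a planar embedding of the subgraph of `G₈` with
the mask `k`, which is connected. The dart that follows the one from `q` to `p` in the rotation goes
from `q` to `next F p q`. The conditions say that this is an injective map that is cyclic at each
vertex (the degrees are at most five) and compatible with the numbers of the faces, that each face
occurs, that each vertex is reached from `v` by at most three steps, and that there are at least as
many faces as Euler's formula asks for. -/
def isFaceList (k : ℕ) (F : List (List G8Vertex)) : Bool :=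
  (all.all fun p => all.all fun q => !k.testBit (edgeIndex p q) ||
    (k.testBit (edgeIndex q (next F p q)) && faceIndex F q (next F p q) == faceIndex F p q &&
      all.all fun r => !k.testBit (edgeIndex r q) ||
        ((next F r q != next F p q || r == p) &&
          (List.range 6).any fun n => (fun t => next F t q)^[n] p == r))) &&
  ((List.range F.length).all fun i => all.any fun p => all.any fun q =>
    k.testBit (edgeIndex p q) && faceIndex F p q == i) &&
  (all.all fun p => all.any fun q => all.any fun r =>
    (q == v || k.testBit (edgeIndex v q)) && (r == q || k.testBit (edgeIndex q r)) &&
      (p == r || k.testBit (edgeIndex r p))) &&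
  decide (((List.range 15).filter fun i => k.testBit i).length + 2 ≤ 8 + F.length) &&
  decide (k < 32768)

section

variable {M : SimpleGraph G8Vertex} {k : ℕ}

theorem card_edgeSet_le (hM : IsMaskOf M k) (hk : k < 32768) :
    Nat.card M.edgeSet ≤ ((List.range 15).filter fun i => k.testBit i).length := by
  set l := (List.range 15).filter fun i => k.testBit i with hl
  have hsub : M.edgeSet ⊆ ((l.map edgeOfIndex).toFinset : Set (Sym2 G8Vertex)) := by
    intro e he
    induction e with
    | _ p q =>
      have hbit := (hM p q).mp he
      have hlt : edgeIndex p q < 15 := by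
        rcases lt_or_eq_of_le (edgeIndex_le p q) with h | h
        · exact h
        · rw [h, Nat.testBit_lt_two_pow (by simpa using hk)] at hbit
          simp at hbit
      simp only [List.coe_toFinset, List.mem_map, Set.mem_ofPred_eq]
      exact ⟨edgeIndex p q, by simp [hl, hlt, hbit], edgeOfIndex_edgeIndex hlt⟩
  rw [Nat.card_coe_set_eq]
  calc M.edgeSet.ncard ≤ ((l.map edgeOfIndex).toFinset : Set (Sym2 G8Vertex)).ncard :=
        Set.ncard_le_ncard hsub (Finset.finite_toSet _)
    _ = (l.map edgeOfIndex).toFinset.card := Set.ncard_coe_finset _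
    _ ≤ l.length := by simpa using List.toFinset_card_le (l.map edgeOfIndex)

/-- The list gives a rotation system with at least the number of faces in Euler's formula; by
`RotationSystem.euler_of_le` this is enough. -/
theorem isPlanar_of_isFaceList {F : List (List G8Vertex)} (h : isFaceList k F = true)
    (hM : IsMaskOf M k) : IsPlanar M := by
  simp only [isFaceList, Bool.and_eq_true, decide_eq_true_eq] at h
  obtain ⟨⟨⟨⟨hrot, hsurj⟩, hconn⟩, hcard⟩, hk⟩ := h
  have key : ∀ p q, M.Adj p q → M.Adj q (next F p q) ∧
      faceIndex F q (next F p q) = faceIndex F p q ∧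
      ∀ r, M.Adj r q → (next F r q = next F p q → r = p) ∧
        ∃ n, (fun t => next F t q)^[n] p = r := by
    intro p q hpq
    have h1 := List.all_eq_true.mp (List.all_eq_true.mp hrot p (mem_all p)) q (mem_all q)
    rw [(hM p q).mp hpq] at h1
    simp only [Bool.not_true, Bool.false_or, Bool.and_eq_true, beq_iff_eq] at h1
    refine ⟨(hM _ _).mpr h1.1.1, h1.1.2, fun r hr => ?_⟩
    have h2 := List.all_eq_true.mp h1.2 r (mem_all r)
    rw [(hM r q).mp hr] at h2
    simp only [Bool.not_true, Bool.false_or, Bool.and_eq_true, Bool.or_eq_true, beq_iff_eq,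
      bne_iff_ne, List.any_eq_true] at h2
    obtain ⟨h3, n, -, hn⟩ := h2
    exact ⟨fun h => h3.resolve_left (fun h' => h' h), n, hn⟩
  let g : M.Dart → M.Dart := fun d => ⟨(d.fst, next F d.snd d.fst), (key _ _ d.adj.symm).1⟩
  have hg : Function.Injective g := by
    intro d d' h
    have h1 : (g d).fst = (g d').fst := by rw [h]
    replace h1 : d.fst = d'.fst := h1
    have h2 : (g d).snd = (g d').snd := by rw [h]
    replace h2 : next F d.snd d.fst = next F d'.snd d'.fst := h2
    have h3 := (key d'.snd d'.fst d'.adj.symm).2.2 d.snd (h1 ▸ d.adj.symm)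
    exact SimpleGraph.Dart.ext _ _ (Prod.ext h1 (h3.1 (by rw [← h2, h1])))
  let R : RotationSystem M :=
    { rot := Equiv.ofBijective g (Finite.injective_iff_bijective.mp hg)
      rot_fst := fun d => rfl
      rot_cyclic := fun d d' hdd => by
        obtain ⟨n, hn⟩ := ((key d.snd d.fst d.adj.symm).2.2 d'.snd (hdd ▸ d'.adj.symm)).2
        refine ⟨n, ?_⟩
        rw [zpow_natCast, Equiv.Perm.coe_pow]
        have hiter : ∀ n : ℕ, (g^[n] d).fst = d.fst ∧
            (g^[n] d).snd = (fun t => next F t d.fst)^[n] d.snd := by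
          intro n
          induction n with
          | zero => exact ⟨rfl, rfl⟩
          | succ n ih =>
            rw [Function.iterate_succ_apply', Function.iterate_succ_apply', ← ih.2]
            exact ⟨ih.1, by change next F _ (g^[n] d).fst = _; rw [ih.1]⟩
        exact SimpleGraph.Dart.ext _ _ (Prod.ext ((hiter n).1.trans hdd) ((hiter n).2.trans hn)) }
  refine R.isPlanar (R.euler_of_le ?_)
  have hedge := card_edgeSet_le hM hk
  have hcomp : Nat.card M.ConnectedComponent ≤ 1 := by
    have hreach : ∀ p, M.Reachable v p := by
      intro p
      have h1 := List.all_eq_true.mp hconn p (mem_all p)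
      simp only [List.any_eq_true, Bool.and_eq_true, Bool.or_eq_true, beq_iff_eq, ← hM _ _] at h1
      obtain ⟨q, -, r, -, ⟨hq, hr⟩, hp⟩ := h1
      have h2 : M.Reachable v q := by
        rcases hq with rfl | hq
        · exact SimpleGraph.Reachable.refl _
        · exact hq.reachable
      have h3 : M.Reachable q r := by
        rcases hr with rfl | hr
        · exact SimpleGraph.Reachable.refl _
        · exact hr.reachable
      have h4 : M.Reachable r p := by
        rcases hp with rfl | hp
        · exact SimpleGraph.Reachable.refl _
        · exact hp.reachable
      exact (h2.trans h3).trans h4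
    have hpre : M.Preconnected := fun p q => (hreach p).symm.trans (hreach q)
    exact Finite.card_le_one_iff_subsingleton.mpr hpre.subsingleton_connectedComponent
  have hface : F.length ≤ Nat.card R.Face := by
    obtain ⟨f, hf⟩ := R.exists_face_function (fun d => faceIndex F d.fst d.snd)
      fun d => (key d.fst d.snd d.adj).2.1
    have hex : ∀ i : Fin F.length, ∃ φ : R.Face, f φ = i := by
      intro i
      have h1 := List.all_eq_true.mp hsurj i (List.mem_range.mpr i.2)
      simp only [List.any_eq_true, Bool.and_eq_true, beq_iff_eq] at h1
      obtain ⟨p, -, q, -, hpq, hi⟩ := h1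
      exact ⟨R.faceOf ⟨(p, q), (hM p q).mpr hpq⟩, (hf _).trans hi⟩
    choose c hc using hex
    have hinj : Function.Injective c := fun i j hij => Fin.ext (by rw [← hc i, ← hc j, hij])
    simpa using Nat.card_le_card_of_injective c hinj
  have hV : Nat.card G8Vertex = 8 := by
    rw [Nat.card_eq_fintype_card]
    rfl
  omega

end

end G8Vertex

/-! ### Symmetries of `G₈` -/

namespace G8Vertex

/-- The transposition of `a` and `b`. -/
def swapAB : G8Vertex → G8Vertex
  | some .a => b
  | some .b => a
  | p => p

/-- The transposition of `x` and `y`. -/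
def swapXY : G8Vertex → G8Vertex
  | some .x => y
  | some .y => x
  | p => p

/-- The exchange of the two parts of size three of `K_{3,3,1}`. -/
def swapParts : G8Vertex → G8Vertex
  | some .a => x
  | some .b => y
  | some .c => z
  | some .x => a
  | some .y => b
  | some .z => c
  | p => p

/-- The eight automorphisms of `G₈`. -/
def symmetries : List (G8Vertex → G8Vertex) :=
  [id, swapAB, swapXY, swapAB ∘ swapXY, swapParts, swapAB ∘ swapParts, swapXY ∘ swapParts,
    swapAB ∘ swapXY ∘ swapParts]

theorem symmetries_spec : symmetries.all (fun σ => all.all fun p => all.all fun q =>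
    decide (edgeIndex (σ p) (σ q) < 15) == decide (edgeIndex p q < 15) &&
      (p == q || σ p != σ q)) = true := by
  decide +kernel

/-- The automorphism of `G₈` given by an element of the list of symmetries. -/
noncomputable def automorphism {σ : G8Vertex → G8Vertex} (hσ : σ ∈ symmetries) : G8 ≃g G8 :=
  have h (p q : G8Vertex) := List.all_eq_true.mp (List.all_eq_true.mp
    (List.all_eq_true.mp symmetries_spec σ hσ) p (mem_all p)) q (mem_all q)
  { toEquiv := Equiv.ofBijective σ (Finite.injective_iff_bijective.mp fun p q hpq => by
      have h' := h p q
      simp only [Bool.and_eq_true, Bool.or_eq_true, beq_iff_eq, bne_iff_ne] at h'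
      exact h'.2.resolve_right fun h'' => h'' hpq)
    map_rel_iff' := fun {p q} => by
      have h' := h p q
      simp only [Bool.and_eq_true, beq_iff_eq, decide_eq_decide] at h'
      rw [adj_iff, adj_iff]
      exact h'.1 }

theorem automorphism_apply {σ : G8Vertex → G8Vertex} (hσ : σ ∈ symmetries) (p : G8Vertex) :
    automorphism hσ p = σ p := rfl

/-- Every extension of the partial automorphism (a list of pairs) to the vertices in the list `l` is
one of the symmetries. The search runs through the partial maps that preserve adjacency and
nonadjacency and are injective. -/
def extensionsAreSymmetries : List G8Vertex → List (G8Vertex × G8Vertex) → Bool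
  | [], f => symmetries.any fun σ => f.all fun e => σ e.1 == e.2
  | p :: l, f => all.all fun q =>
      !(f.all fun e => decide (edgeIndex e.1 p < 15) == decide (edgeIndex e.2 q < 15) &&
          (e.1 == p || e.2 != q)) ||
        extensionsAreSymmetries l ((p, q) :: f)

theorem exists_symmetry_of_extensions (φ : G8 ≃g G8) (l : List G8Vertex)
    (f : List (G8Vertex × G8Vertex)) (hf : ∀ e ∈ f, φ e.1 = e.2)
    (h : extensionsAreSymmetries l f = true) (hl : ∀ p, p ∈ l ∨ ∃ q, (p, q) ∈ f) :
    ∃ σ ∈ symmetries, ∀ p, φ p = σ p := by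
  induction l generalizing f with
  | nil =>
    simp only [extensionsAreSymmetries, List.any_eq_true, List.all_eq_true, beq_iff_eq] at h
    obtain ⟨σ, hσ, h⟩ := h
    refine ⟨σ, hσ, fun p => ?_⟩
    obtain ⟨q, hq⟩ := (hl p).resolve_left (by simp)
    exact (hf _ hq).trans (h _ hq).symm
  | cons p l ih =>
    have h1 := List.all_eq_true.mp h (φ p) (mem_all _)
    have h2 : (f.all fun e =>
        decide (edgeIndex e.1 p < 15) == decide (edgeIndex e.2 (φ p) < 15) &&
          (e.1 == p || e.2 != φ p)) = true := by
      refine List.all_eq_true.mpr fun e he => ?_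
      rw [Bool.and_eq_true, beq_iff_eq, decide_eq_decide, ← adj_iff, ← adj_iff, ← hf e he,
        Bool.or_eq_true, beq_iff_eq, bne_iff_ne, ne_eq, φ.injective.eq_iff]
      exact ⟨(φ.map_rel_iff (a := e.1) (b := p)).symm, em _⟩
    rw [h2, Bool.not_true, Bool.false_or] at h1
    refine ih _ (fun e he => ?_) h1 fun q => ?_
    · rcases List.mem_cons.mp he with rfl | he
      · rfl
      · exact hf e he
    · rcases hl q with hq | ⟨r, hr⟩
      · rcases List.mem_cons.mp hq with rfl | hq
        · exact Or.inr ⟨_, List.mem_cons_self⟩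
        · exact Or.inl hq
      · exact Or.inr ⟨r, List.mem_cons_of_mem _ hr⟩

/-- The automorphism group of `G₈` has no other elements. -/
theorem exists_symmetry (φ : G8 ≃g G8) : ∃ σ ∈ symmetries, ∀ p, φ p = σ p :=
  exists_symmetry_of_extensions φ [v, w, c, z, a, b, x, y] [] (by simp) (by decide +kernel)
    fun p => Or.inl (by revert p; decide)

/-! ### The maximal planar subgraphs -/

/-- The mask of a list of edges. -/
def removalMask (l : List (G8Vertex × G8Vertex)) : ℕ :=
  l.foldr (fun e m => edgeMask e ||| m) 0

/-- The mask of the edges of `G₈` that are not in the list. -/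
def restMask (l : List (G8Vertex × G8Vertex)) : ℕ :=
  (removalMask l ^^^ 32767) &&& 32767

theorem testBit_restMask (l : List (G8Vertex × G8Vertex)) (p q : G8Vertex) :
    (restMask l).testBit (edgeIndex p q) = true ↔
      G8.Adj p q ∧ ¬ (removalMask l).testBit (edgeIndex p q) = true := by
  have h : Nat.testBit 32767 (edgeIndex p q) = decide (edgeIndex p q < 15) :=
    Nat.testBit_two_pow_sub_one 15 _
  rw [restMask, Nat.testBit_and, Nat.testBit_xor, h, adj_iff]
  by_cases h' : edgeIndex p q < 15 <;> simp [h']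

/-- The subgraph of `G₈` that remains after the removal of the edges in the list. -/
def remaining (l : List (G8Vertex × G8Vertex)) : SimpleGraph G8Vertex where
  Adj p q := (restMask l).testBit (edgeIndex p q) = true
  symm := ⟨fun p q h => by rwa [edgeIndex_comm]⟩
  loopless := ⟨fun p h => ((testBit_restMask l p p).mp h).1.ne rfl⟩

theorem isMaskOf_remaining (l : List (G8Vertex × G8Vertex)) :
    IsMaskOf (remaining l) (restMask l) :=
  fun _ _ => Iff.rfl

theorem remaining_le (l : List (G8Vertex × G8Vertex)) : remaining l ≤ G8 :=
  fun p q h => ((testBit_restMask l p q).mp h).1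

/-- The image of a list of edges under a map of the vertices. -/
def mapEdges (σ : G8Vertex → G8Vertex) (l : List (G8Vertex × G8Vertex)) :
    List (G8Vertex × G8Vertex) :=
  l.map fun e => (σ e.1, σ e.2)

/-- The data of a maximal planar subgraph of `G₈`. -/
structure MaximalSubgraphData where
  /-- the fragments -/
  removed : List (G8Vertex × G8Vertex)
  /-- the faces of an embedding -/
  faces : List (List G8Vertex)
  /-- signed edges of the strong conflict graph that form an unbalanced cycle: a strong conflict and
  a strong anti-conflict if there are two fragments, and the edges that join the first two fragments,
  the first and the last one, and the last two fragments if there are three -/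
  signedEdges : List SignedEdgeData

/-- The fourteen subgraphs of the list, and the sibling of the fifth one. -/
def maximalSubgraphData : Fin 15 → MaximalSubgraphData :=
  ![
    ⟨[(a, x), (a, y), (b, y)],
      [[v, a, z, w],
        [v, b, z, a],
        [v, x, b],
        [v, y, c, x],
        [v, w, c, y],
        [b, x, c, w, z]],
      [⟨false, (a, y), (a, x),
        [a, x, c, y], [v, b, z, w], [], [],
        ⟨v, [v, a, z, b], [v, a, z, w], [v, b, z, w], [w, c, x], [b, x], [a]⟩⟩,
       ⟨true, (a, x), (b, y),
        [v, a, x], [b, y, c, w, z], [a, x, c, w, z], [v, b, y],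
        ⟨x, [x, v, a, z, b], [x, c, w, z, b], [x, v, a, z, w, c], [c, y], [v, y], [b]⟩⟩,
       ⟨false, (a, y), (b, y),
        [a, y, b, z], [v, x, c, w], [], [],
        ⟨x, [x, b, z, w, v], [x, c, w, z, b], [x, c, w, v], [c, y], [v, y], [b]⟩⟩]⟩,
    ⟨[(a, z), (b, y)],
      [[v, a, y],
        [v, x, a],
        [v, b, x],
        [v, w, z, b],
        [v, y, c, w],
        [a, x, c, y],
        [b, z, w, c, x]],
      [⟨true, (a, z), (b, y),
        [v, a, z, w], [b, x, c, y], [a, x, c, w, z], [v, b, y],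
        ⟨x, [x, b, v, a], [x, c, w, v, b], [x, c, w, v, a], [c, y], [a, y], [b]⟩⟩,
       ⟨false, (b, y), (a, z),
        [a, y, b, z], [v, x, c, w], [], [],
        ⟨v, [v, x, c, y], [v, y, c, w], [v, x, c, w], [w, z], [x, b, z], [y, a]⟩⟩]⟩,
    ⟨[(b, z), (c, y)],
      [[v, a, z, w],
        [v, y, a],
        [v, b, y],
        [v, x, b],
        [v, w, c, x],
        [a, x, c, w, z],
        [a, y, b, x]],
      [⟨true, (b, z), (c, y),
        [v, b, z, w], [a, x, c, y], [a, x, b, z], [v, y, c, w],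
        ⟨x, [x, c, w, v, b], [x, c, w, z, a], [x, a, z, w, v, b], [a, y], [b, y], [c]⟩⟩,
       ⟨false, (c, y), (b, z),
        [b, y, c, w, z], [v, a, x], [], [],
        ⟨b, [b, v, a, y], [b, y, a, x], [b, x, v], [x, c, w, z], [v, w, z], [y, a, z]⟩⟩]⟩,
    ⟨[(v, a), (v, y), (b, y)],
      [[v, b, z, w],
        [v, x, b],
        [v, w, c, x],
        [a, x, c, y],
        [a, z, b, x],
        [a, y, c, w, z]],
      [⟨false, (v, y), (v, a),
        [v, a, y], [b, x, c, w, z], [], [],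
        ⟨b, [b, x, c, w, v], [b, z, w, v], [b, x, c, w, z], [z, a], [x, a], [v]⟩⟩,
       ⟨true, (b, y), (v, a),
        [b, x, c, y], [v, a, z, w], [b, y, c, w, z], [v, a, x],
        ⟨b, [b, x, c, w, v], [b, z, w, v], [b, x, c, w, z], [z, a], [x, a], [v]⟩⟩,
       ⟨false, (b, y), (v, y),
        [v, b, y], [a, x, c, w, z], [], [],
        ⟨x, [x, a, z, w, v], [x, c, w, v], [x, c, w, z, a], [c, y], [a, y], [v]⟩⟩]⟩,
    ⟨[(v, y), (b, x), (b, y)],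
      [[v, a, x],
        [v, b, z, a],
        [v, w, z, b],
        [v, x, c, w],
        [a, y, c, x],
        [a, z, w, c, y]],
      [⟨true, (b, x), (v, y),
        [a, x, b, z], [v, y, c, w], [b, x, c, w, z], [v, a, y],
        ⟨x, [x, a, z, w, v], [x, c, w, v], [x, c, w, z, a], [c, y], [a, y], [v]⟩⟩,
       ⟨false, (b, y), (v, y),
        [v, b, y], [a, x, c, w, z], [], [],
        ⟨x, [x, a, z, w, v], [x, c, w, v], [x, c, w, z, a], [c, y], [a, y], [v]⟩⟩,
       ⟨false, (b, y), (b, x),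
        [b, x, c, y], [v, a, z, w], [], [],
        ⟨v, [v, a, z, b], [v, b, z, w], [v, a, z, w], [w, c, x], [a, x], [b]⟩⟩]⟩,
    ⟨[(v, b), (b, y), (c, y)],
      [[v, a, y],
        [v, x, a],
        [v, w, c, x],
        [v, y, a, z, w],
        [a, x, b, z],
        [b, x, c, w, z]],
      [⟨false, (b, y), (v, b),
        [v, b, y], [a, x, c, w, z], [], [],
        ⟨a, [a, x, c, w, v], [a, z, w, v], [a, x, c, w, z], [z, b], [x, b], [v]⟩⟩,
       ⟨true, (c, y), (v, b),
        [a, x, c, y], [v, b, z, w], [a, y, c, w, z], [v, b, x],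
        ⟨a, [a, x, c, w, v], [a, z, w, v], [a, x, c, w, z], [z, b], [x, b], [v]⟩⟩,
       ⟨false, (c, y), (b, y),
        [b, x, c, y], [v, a, z, w], [b, y, c, w, z], [v, a, x],
        ⟨x, [x, b, z, w, v], [x, b, z, a], [x, a, z, w, v], [a, y], [v, y], [b]⟩⟩]⟩,
    ⟨[(v, y), (c, x), (c, y)],
      [[v, a, z, w],
        [v, x, a],
        [v, b, x],
        [v, w, c, w, z, b],
        [a, y, b, z],
        [a, x, b, y]],
      [⟨true, (c, x), (v, y),
        [a, x, c, w, z], [v, b, y], [b, x, c, w, z], [v, a, y],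
        ⟨x, [x, a, z, w, v], [x, b, z, w, v], [x, b, z, a], [b, y], [a, y], [v]⟩⟩,
       ⟨false, (c, y), (v, y),
        [v, y, c, w], [a, x, b, z], [], [],
        ⟨x, [x, a, z, w, v], [x, b, z, w, v], [x, b, z, a], [b, y], [a, y], [v]⟩⟩,
       ⟨false, (c, y), (c, x),
        [a, x, c, y], [v, b, z, w], [b, x, c, y], [v, a, z, w],
        ⟨v, [v, a, z, w], [v, b, z, w], [v, a, z, b], [b, x], [a, x], [w, c]⟩⟩]⟩,
    ⟨[(v, w), (a, x), (b, y)],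
      [[v, a, y],
        [v, b, z, a],
        [v, x, b],
        [v, y, c, x],
        [a, z, w, c, y],
        [b, x, c, w, z]],
      [⟨true, (v, w), (a, x),
        [v, b, z, w], [a, x, c, y], [v, y, c, w], [a, x, b, z],
        ⟨y, [y, v, b, z, a], [y, c, w, z, a], [y, v, b, z, w, c], [c, x], [v, x], [a]⟩⟩,
       ⟨true, (v, w), (b, y),
        [v, a, z, w], [b, x, c, y], [v, x, c, w], [a, y, b, z],
        ⟨x, [x, v, a, z, b], [x, c, w, z, b], [x, v, a, z, w, c], [c, y], [v, y], [b]⟩⟩,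
       ⟨true, (a, x), (b, y),
        [v, a, x], [b, y, c, w, z], [a, x, c, w, z], [v, b, y],
        ⟨x, [x, v, a, z, b], [x, c, w, z, b], [x, v, a, z, w, c], [c, y], [v, y], [b]⟩⟩]⟩,
    ⟨[(v, w), (v, b), (b, y)],
      [[v, a, y],
        [v, x, a],
        [v, y, c, x],
        [a, z, w, c, y],
        [a, x, b, z],
        [b, x, c, w, z]],
      [⟨false, (v, b), (v, w),
        [v, b, z, w], [a, x, c, y], [], [],
        ⟨x, [x, a, y, v], [x, c, y, v], [x, c, y, a], [c, w], [a, z, w], [v]⟩⟩,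
       ⟨true, (v, w), (b, y),
        [v, a, z, w], [b, x, c, y], [v, x, c, w], [a, y, b, z],
        ⟨x, [x, v, a, z, b], [x, c, w, z, b], [x, v, a, z, w, c], [c, y], [v, y], [b]⟩⟩,
       ⟨false, (v, b), (b, y),
        [v, b, y], [a, x, c, w, z], [], [],
        ⟨x, [x, b, z, a], [x, c, w, z, b], [x, c, w, z, a], [c, y], [a, y], [b]⟩⟩]⟩,
    ⟨[(v, w), (b, z)],
      [[v, a, y],
        [v, x, a],
        [v, b, x],
        [v, y, b],
        [a, z, w, c, y],
        [a, x, c, w, z],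
        [b, y, c, x]],
      [⟨true, (v, w), (b, z),
        [v, x, c, w], [a, y, b, z], [v, y, c, w], [a, x, b, z],
        ⟨x, [x, b, y, v], [x, c, y, b], [x, c, y, v], [c, w, z], [v, a, z], [b]⟩⟩,
       ⟨false, (b, z), (v, w),
        [v, b, z, w], [a, x, c, y], [], [],
        ⟨x, [x, a, y, v], [x, c, y, v], [x, c, y, a], [c, w], [a, z, w], [v]⟩⟩]⟩,
    ⟨[(c, w), (b, y)],
      [[v, a, z, w],
        [v, y, a],
        [v, x, c, y],
        [v, b, x],
        [v, w, z, b],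
        [a, x, b, z],
        [a, y, c, x]],
      [⟨true, (c, w), (b, y),
        [v, x, c, w], [a, y, b, z], [a, x, c, w, z], [v, b, y],
        ⟨x, [x, b, z, w, v], [x, b, z, a], [x, a, z, w, v], [a, y], [v, y], [b]⟩⟩,
       ⟨false, (c, w), (b, y),
        [b, y, c, w, z], [v, a, x], [], [],
        ⟨b, [b, v, a, z], [b, z, a, x], [b, x, v], [x, c, y], [v, y], [z, a, y]⟩⟩]⟩,
    ⟨[(c, w), (v, y)],
      [[v, a, z, w],
        [v, x, a],
        [v, b, x],
        [v, w, z, b],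
        [a, y, b, z],
        [a, x, c, y],
        [b, y, c, x]],
      [⟨true, (c, w), (v, y),
        [a, x, c, w, z], [v, b, y], [b, x, c, w, z], [v, a, y],
        ⟨x, [x, a, z, w, v], [x, b, z, w, v], [x, b, z, a], [b, y], [a, y], [v]⟩⟩,
       ⟨false, (v, y), (c, w),
        [v, y, c, w], [a, x, b, z], [], [],
        ⟨a, [a, x, b, y], [a, y, b, z], [a, x, b, z], [z, w], [x, v, w], [y, c]⟩⟩]⟩,
    ⟨[(c, w), (b, z)],
      [[v, a, z, w],
        [v, x, a],
        [v, b, x],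
        [v, y, b],
        [v, w, z, a, y],
        [a, x, c, y],
        [b, y, c, x]],
      [⟨true, (b, z), (c, w),
        [a, x, b, z], [v, y, c, w], [a, y, b, z], [v, x, c, w],
        ⟨x, [x, c, y, a], [x, c, y, b], [x, b, y, a], [b, v, w], [a, v, w], [c]⟩⟩,
       ⟨false, (b, z), (c, w),
        [b, x, c, w, z], [v, a, y], [b, y, c, w, z], [v, a, x],
        ⟨x, [x, c, y, v], [x, c, y, a], [x, a, y, v], [a, z, w], [v, w], [c]⟩⟩]⟩,
    ⟨[(v, w), (c, w), (v, b)],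
      [[v, a, y],
        [v, x, a],
        [v, y, c, x],
        [a, z, b, y],
        [a, x, b, z, w, z],
        [b, x, c, y]],
      [⟨false, (c, w), (v, w),
        [v, x, c, w], [a, y, b, z], [v, y, c, w], [a, x, b, z],
        ⟨x, [x, a, y, v], [x, b, y, v], [x, b, y, a], [b, z, w], [a, z, w], [v]⟩⟩,
       ⟨false, (v, w), (v, b),
        [v, b, z, w], [a, x, c, y], [], [],
        ⟨v, [v, a, x], [v, x, c, y], [v, a, y], [y, b], [a, z, b], [x, b]⟩⟩,
       ⟨true, (v, b), (c, w),
        [v, b, x], [a, y, c, w, z], [v, b, y], [a, x, c, w, z],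
        ⟨x, [x, c, y, v], [x, c, y, b], [x, b, y, v], [b, z, w], [v, a, z, w], [c]⟩⟩]⟩,
    ⟨[(v, b), (v, y), (c, y)],
      [[v, a, z, w],
        [v, x, a],
        [v, w, c, x],
        [a, y, b, z],
        [a, x, b, y],
        [b, x, c, w, z]],
      [⟨false, (v, y), (v, b),
        [v, b, y], [a, x, c, w, z], [], [],
        ⟨a, [a, x, c, w, v], [a, z, w, v], [a, x, c, w, z], [z, b], [x, b], [v]⟩⟩,
       ⟨true, (c, y), (v, b),
        [a, x, c, y], [v, b, z, w], [a, y, c, w, z], [v, b, x],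
        ⟨a, [a, x, c, w, v], [a, z, w, v], [a, x, c, w, z], [z, b], [x, b], [v]⟩⟩,
       ⟨false, (c, y), (v, y),
        [v, y, c, w], [a, x, b, z], [], [],
        ⟨x, [x, a, z, w, v], [x, b, z, w, v], [x, b, z, a], [b, y], [a, y], [v]⟩⟩]⟩]

/-- The subgraph with the given number. -/
def maximalSubgraph (i : Fin 15) : SimpleGraph G8Vertex :=
  remaining (maximalSubgraphData i).removed

theorem listedSubgraph_eq (i : Fin 14) : listedSubgraph i = maximalSubgraph i.castSucc := by
  ext p q
  rw [listedSubgraph, SimpleGraph.deleteEdges_adj, adj_iff]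
  change _ ↔ (restMask _).testBit _ = true
  fin_cases i <;>
  · simp only [removedEdges, Fin.zero_eta, Fin.mk_one, Fin.reduceFinMk, Matrix.cons_val,
      Set.mem_insert_iff, Set.mem_singleton_iff]
    revert p q
    decide +kernel

theorem siblingSubgraph_eq : siblingSubgraph = maximalSubgraph (Fin.last 14) := by
  ext p q
  rw [siblingSubgraph, SimpleGraph.deleteEdges_adj, adj_iff]
  change _ ↔ (restMask _).testBit _ = true
  simp only [Set.mem_insert_iff, Set.mem_singleton_iff]
  revert p q
  decide +kernel

theorem isFaceList_maximalSubgraph (i : Fin 15) :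
    isFaceList (restMask (maximalSubgraphData i).removed) (maximalSubgraphData i).faces = true := by
  revert i
  decide +kernel

theorem isPlanar_maximalSubgraph (i : Fin 15) : IsPlanar (maximalSubgraph i) :=
  isPlanar_of_isFaceList (isFaceList_maximalSubgraph i) (isMaskOf_remaining _)

/-! ### The minimal nonplanar subgraphs -/

/-- Subdivisions of `K_{3,3}` and of `K₅` in `G₈`, given by claws, with a path that avoids the sum of
the walks of the claw; all others are equivalent to these ones. -/
def obstructions : List (Claw × List G8Vertex) :=
  [
    (⟨v, [v, x, b, y], [v, y, b, z, w], [v, x, b, z, w], [w, z, a], [x, a], [y, a]⟩, [x, a]),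
    (⟨v, [v, a, z, b], [v, b, z, w], [v, a, z, w], [w, c], [a, x, c], [b, x, c]⟩, [a, x, c]),
    (⟨v, [v, b, z, a, y], [v, y, a, z, w], [v, b, z, w], [w, c], [b, x, c], [y, a, x, c]⟩, [b, x, c]),
    (⟨a, [a, x, b, y], [a, y, b, z], [a, x, b, z], [z, w, v], [x, c, w, v], [y, v]⟩, [x, b, y, v]),
    (⟨v, [v, b, z, w, c, x], [v, x, c, y], [v, b, z, w, c, y], [y, a], [b, z, a], [x, a]⟩, [b, z, a]),
    (⟨v, [v, a, z, b], [v, b, z, w], [v, a, z, w], [w, c], [a, y, c], [b, x, c]⟩, [a, y, c]),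
    (⟨v, [v, a, y, c, x], [v, x, c, w], [v, a, y, c, w], [w, z, b], [a, z, b], [x, b]⟩, [a, z, b]),
    (⟨a, [a, x, c, y], [a, y, c, w, z], [a, x, c, w, z], [z, b, v], [x, b, v], [y, v]⟩, [x, b, v]),
    (⟨v, [v, b, x], [v, x, c, y], [v, b, y], [y, a], [b, z, a], [x, a]⟩, [a]),
    (⟨a, [a, x, c, y], [a, y, c, w, z], [a, x, c, w, z], [z, b], [x, b], [y, b]⟩, [x, b])]

/-- The masks of all minimal nonplanar subgraphs of `G₈`. Their order matters only for the length of
the search in `transversals_obstructionMasks`. -/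
def obstructionMasks : List ℕ :=
  [8156, 14067, 23411, 25596, 28083, 31868, 32736, 14330, 16121, 16376, 23542, 24437, 24564,
   26618, 27638, 28658, 29678, 30443, 30579, 30581, 30586, 30588, 30698, 31475, 31478, 31481,
   31484, 31591, 31718, 31993, 32117, 32241, 32365, 32489, 32613, 32655]

/-- The masks of all sets of edges that are equivalent under a symmetry of `G₈` to one of those in
`maximalSubgraphData`. -/
def removalMasks : List ℕ :=
  [36, 40, 49, 50, 65, 66, 84, 88, 134, 137, 145, 148, 160, 192, 261, 266, 273, 280, 288, 320,
   388, 392, 517, 521, 528, 544, 644, 776, 1029, 1034, 1042, 1044, 1056, 1088, 1153, 1154, 1296,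
   1408, 1536, 2054, 2057, 2066, 2072, 2080, 2112, 2192, 2305, 2306, 2432, 2560, 3076, 3080,
   3200, 3328, 4102, 4106, 4112, 4128, 4224, 4352, 4609, 4610, 5124, 6152, 8197, 8198, 8208,
   8256, 8321, 8448, 8704, 9218, 10240, 12288, 16393, 16394, 16400, 16448, 16512, 16641, 16896,
   17408, 18434, 20480, 24580, 24584]

theorem isObstruction_of_mem : obstructionMasks.all (fun k => obstructions.any fun C =>
    symmetries.any fun σ => (C.1.map σ).isObstruction k (C.2.map σ)) = true := by
  decide +kernel

theorem removalMasks_spec : removalMasks.all (fun m => (List.finRange 15).any fun i =>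
    symmetries.any fun σ => removalMask (mapEdges σ (maximalSubgraphData i).removed) == m) =
      true := by
  decide +kernel

/-- Each set of edges that contains `T` and meets all sets in the list contains one of the sets in
`Hs`. All sets are given by masks. -/
def transversalsContain (Hs : List ℕ) : List ℕ → ℕ → Bool
  | [], T => Hs.any fun H => isSubmask H T
  | K :: Ks, T =>
    if K &&& T == 0 then
      (List.range 15).all fun i => !K.testBit i || transversalsContain Hs Ks (T ||| 1 <<< i)
    else transversalsContain Hs Ks T

theorem exists_subset_of_transversal {Hs Ks : List ℕ} {T : ℕ}
    (h : transversalsContain Hs Ks T = true) {P : ℕ → Prop}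
    (hKs : ∀ K ∈ Ks, ∃ i < 15, K.testBit i = true ∧ P i) (hT : ∀ i, T.testBit i = true → P i) :
    ∃ H ∈ Hs, ∀ i, H.testBit i = true → P i := by
  induction Ks generalizing T with
  | nil =>
    obtain ⟨H, hH, h⟩ := List.any_eq_true.mp h
    exact ⟨H, hH, fun i hi => hT i (testBit_of_isSubmask h hi)⟩
  | cons K Ks ih =>
    have hKs' := fun L hL => hKs L (List.mem_cons_of_mem _ hL)
    rw [transversalsContain] at h
    split at h
    · obtain ⟨i, hi, hKi, hPi⟩ := hKs K List.mem_cons_self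
      have h1 := List.all_eq_true.mp h i (List.mem_range.mpr hi)
      rw [hKi, Bool.not_true, Bool.false_or] at h1
      refine ih h1 hKs' fun j hj => ?_
      rw [Nat.testBit_or, Bool.or_eq_true, Nat.one_shiftLeft, Nat.testBit_two_pow,
        decide_eq_true_eq] at hj
      rcases hj with hj | rfl
      · exact hT j hj
      · exact hPi
    · exact ih h hKs' hT

/-- Each set of edges that meets all obstructions contains one of the 86 sets. -/
theorem transversals_obstructionMasks :
    transversalsContain removalMasks obstructionMasks 0 = true := by
  decide +kernel

/-- Planar graphs do not contain an obstruction. -/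
theorem not_isPlanar_of_contains {K : ℕ} (hK : K ∈ obstructionMasks) {M : SimpleGraph G8Vertex}
    (hM : Contains M K) : ¬ IsPlanar M := by
  have h := List.all_eq_true.mp isObstruction_of_mem K hK
  simp only [List.any_eq_true] at h
  obtain ⟨C, -, σ, -, h⟩ := h
  exact Claw.not_isPlanar h hM

/-- A planar subgraph of `G₈` is contained in the image of one of the fifteen graphs under a symmetry
of `G₈`. -/
theorem exists_le_of_isPlanar {M : SimpleGraph G8Vertex} (hle : M ≤ G8) (hM : IsPlanar M) :
    ∃ i, ∃ σ ∈ symmetries, M ≤ remaining (mapEdges σ (maximalSubgraphData i).removed) := by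
  have hmeet : ∀ K ∈ obstructionMasks, ∃ i < 15, K.testBit i = true ∧
      ∀ p q, edgeIndex p q = i → ¬ M.Adj p q := by
    intro K hK
    have hnc : ¬ Contains M K := fun hc => not_isPlanar_of_contains hK hc hM
    simp only [Contains, not_forall] at hnc
    obtain ⟨p, q, hbit, hpq⟩ := hnc
    have hlt : edgeIndex p q < 15 := by
      have h15 : ∀ K ∈ obstructionMasks, K < 32768 := by decide +kernel
      rcases lt_or_eq_of_le (edgeIndex_le p q) with h | h
      · exact h
      · rw [h, Nat.testBit_lt_two_pow (by simpa using h15 K hK)] at hbit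
        simp at hbit
    refine ⟨edgeIndex p q, hlt, hbit, fun r t hrt hadj => hpq ?_⟩
    have := eq_of_edgeIndex_eq hrt (hrt ▸ hlt)
    rwa [← SimpleGraph.mem_edgeSet, ← this, SimpleGraph.mem_edgeSet]
  obtain ⟨H, hH, h⟩ := exists_subset_of_transversal transversals_obstructionMasks hmeet (by simp)
  have h' := List.all_eq_true.mp removalMasks_spec H hH
  simp only [List.any_eq_true, beq_iff_eq] at h'
  obtain ⟨i, -, σ, hσ, rfl⟩ := h'
  exact ⟨i, σ, hσ, fun p q hpq => (testBit_restMask _ p q).mpr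
    ⟨hle hpq, fun hbit => h _ hbit p q rfl hpq⟩⟩

theorem testBit_restMask_map : ∀ i, symmetries.all (fun σ => all.all fun p => all.all fun q =>
    (restMask (mapEdges σ (maximalSubgraphData i).removed)).testBit (edgeIndex (σ p) (σ q)) ==
      (restMask (maximalSubgraphData i).removed).testBit (edgeIndex p q)) = true := by
  decide +kernel

theorem remaining_map_adj (i : Fin 15) {σ : G8Vertex → G8Vertex} (hσ : σ ∈ symmetries)
    (p q : G8Vertex) : (remaining (mapEdges σ (maximalSubgraphData i).removed)).Adj (σ p) (σ q) ↔
      (maximalSubgraph i).Adj p q := by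
  have h := List.all_eq_true.mp (List.all_eq_true.mp
    (List.all_eq_true.mp (testBit_restMask_map i) σ hσ) p (mem_all p)) q (mem_all q)
  rw [beq_iff_eq] at h
  change (restMask _).testBit _ = true ↔ (restMask _).testBit _ = true
  rw [h]

theorem remaining_map_adj_iff (i : Fin 15) {σ : G8Vertex → G8Vertex} (hσ : σ ∈ symmetries)
    (p q : G8Vertex) : (remaining (mapEdges σ (maximalSubgraphData i).removed)).Adj p q ↔
      (maximalSubgraph i).Adj ((automorphism hσ).symm p) ((automorphism hσ).symm q) := by
  rw [← remaining_map_adj i hσ, ← automorphism_apply hσ, ← automorphism_apply hσ,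
    RelIso.apply_symm_apply, RelIso.apply_symm_apply]

/-- Each maximal planar subgraph is the image of one of the fifteen graphs: it is contained in one of
the images, which is planar. -/
theorem exists_eq_of_isMaximalPlanarSubgraph {M : SimpleGraph G8Vertex}
    (hM : IsMaximalPlanarSubgraph G8 M) :
    ∃ i, ∃ σ ∈ symmetries, M = remaining (mapEdges σ (maximalSubgraphData i).removed) := by
  obtain ⟨hle, hpl, hmax⟩ := hM
  obtain ⟨i, σ, hσ, h⟩ := exists_le_of_isPlanar hle hpl
  refine ⟨i, σ, hσ, le_antisymm h fun p q hpq => ?_⟩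
  by_contra hnot
  refine hmax s(p, q) ⟨remaining_le _ hpq, hnot⟩ (IsPlanar.mono
    (N := remaining (mapEdges σ (maximalSubgraphData i).removed)) (sup_le h ?_) ?_)
  · intro r t hrt
    rw [SimpleGraph.fromEdgeSet_adj, Set.mem_singleton_iff] at hrt
    rw [← SimpleGraph.mem_edgeSet, hrt.1]
    exact hpq
  · exact (isPlanar_maximalSubgraph i).of_hom
      ⟨(automorphism hσ).symm, fun {p q} h => (remaining_map_adj_iff i hσ p q).mp h⟩
      (automorphism hσ).symm.injective

theorem equivalentUnderAut_maximalSubgraph (i : Fin 15) {σ : G8Vertex → G8Vertex}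
    (hσ : σ ∈ symmetries) :
    EquivalentUnderAut G8 (remaining (mapEdges σ (maximalSubgraphData i).removed))
      (maximalSubgraph i) :=
  ⟨(automorphism hσ).symm, remaining_map_adj_iff i hσ⟩

/-- The insertion of an edge of `G₈` into one of the fifteen graphs creates an obstruction. -/
theorem exists_obstruction_of_insert : ∀ i, all.all (fun p => all.all fun q =>
    !decide (edgeIndex p q < 15) ||
      (restMask (maximalSubgraphData i).removed).testBit (edgeIndex p q) ||
        obstructionMasks.any fun K => isSubmask K
          (restMask (maximalSubgraphData i).removed ||| edgeMask (p, q))) = true := by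
  decide +kernel

theorem isMaximalPlanarSubgraph_maximalSubgraph (i : Fin 15) :
    IsMaximalPlanarSubgraph G8 (maximalSubgraph i) := by
  refine ⟨remaining_le _, isPlanar_maximalSubgraph i, fun e he => ?_⟩
  induction e with
  | _ p q =>
    have hadj : edgeIndex p q < 15 := (adj_iff p q).mp he.1
    have h := List.all_eq_true.mp (List.all_eq_true.mp (exists_obstruction_of_insert i) p
      (mem_all p)) q (mem_all q)
    have hbit : ¬ (restMask (maximalSubgraphData i).removed).testBit (edgeIndex p q) = true :=
      he.2
    simp only [Bool.or_eq_true, hbit, hadj, decide_true, Bool.not_true, Bool.false_eq_true,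
      false_or, List.any_eq_true] at h
    obtain ⟨K, hK, hsub⟩ := h
    refine not_isPlanar_of_contains hK fun r t hrt => ?_
    have h1 := testBit_of_isSubmask hsub hrt
    rw [Nat.testBit_or, Bool.or_eq_true] at h1
    rw [SimpleGraph.sup_adj, SimpleGraph.fromEdgeSet_adj, Set.mem_singleton_iff]
    rcases h1 with h1 | h1
    · exact Or.inl h1
    · have heq : s(r, t) = s(p, q) := testBit_edgeMask (e := (p, q)) hadj h1
      refine Or.inr ⟨heq, fun hrt' => ?_⟩
      subst hrt'
      have : G8.Adj r r := by
        rw [← SimpleGraph.mem_edgeSet, heq]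
        exact he.1
      exact this.ne rfl

/-- No symmetry maps one of the fourteen graphs of the statement to another one. -/
theorem restMask_ne : ∀ i j : Fin 14, i = j ∨ symmetries.all (fun σ => all.any fun p =>
    all.any fun q =>
      (restMask (maximalSubgraphData i.castSucc).removed).testBit (edgeIndex p q) !=
        (restMask (maximalSubgraphData j.castSucc).removed).testBit (edgeIndex (σ p) (σ q))) =
      true := by
  decide +kernel

theorem eq_of_equivalentUnderAut {i j : Fin 14}
    (h : EquivalentUnderAut G8 (maximalSubgraph i.castSucc) (maximalSubgraph j.castSucc)) :
    i = j := by
  obtain ⟨φ, hφ⟩ := h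
  obtain ⟨σ, hσ, h⟩ := exists_symmetry φ
  refine (restMask_ne i j).resolve_right fun hne => ?_
  have h1 := List.all_eq_true.mp hne σ hσ
  simp only [List.any_eq_true, bne_iff_ne] at h1
  obtain ⟨p, -, q, -, hpq⟩ := h1
  have h2 := hφ p q
  rw [h, h] at h2
  exact hpq (Bool.eq_iff_iff.mpr h2)

/-- An isomorphism from the sibling to the fifth subgraph of the list. -/
def siblingMap : G8Vertex → G8Vertex
  | some .v => x
  | some .a => v
  | some .b => z
  | some .c => y
  | some .x => a
  | some .y => b
  | some .z => w
  | none => c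

theorem siblingMap_injective : Function.Injective siblingMap := by
  intro p q
  revert p q
  decide +kernel

theorem testBit_siblingMap : ∀ p q,
    (restMask (maximalSubgraphData 4).removed).testBit (edgeIndex (siblingMap p) (siblingMap q)) =
      (restMask (maximalSubgraphData (Fin.last 14)).removed).testBit (edgeIndex p q) := by
  decide +kernel

/-- The sibling is isomorphic to the fifth subgraph of the list. -/
noncomputable def siblingIso : maximalSubgraph (Fin.last 14) ≃g maximalSubgraph 4 where
  toEquiv := Equiv.ofBijective siblingMap (Finite.injective_iff_bijective.mp siblingMap_injective)
  map_rel_iff' := fun {p q} => Bool.eq_iff_iff.mp (testBit_siblingMap p q)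

end G8Vertex

/-! ### Unbalanced cycles -/

theorem SignedGraph.not_balanced_of_digon {W : Type*} {S : SignedGraph W} {p q : W}
    (h : S.Edge p q (-1)) (h' : S.Edge p q 1) : ¬ S.Balanced := by
  intro hS
  have hne : p ≠ q := by
    rintro rfl
    exact S.loopless _ _ h
  have := hS 0 ![p, q] ![-1, 1] (by
    intro i j hij
    fin_cases i <;> fin_cases j <;> simp_all) (by
    intro i
    fin_cases i
    · exact h
    · exact S.symm _ _ _ h')
  simp at this

theorem SignedGraph.not_balanced_of_triangle {W : Type*} {S : SignedGraph W} {p q r : W}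
    {s t u : ℤˣ} (hpq : S.Edge p q s) (hpr : S.Edge p r t) (hqr : S.Edge q r u)
    (h : s * t * u ≠ 1) : ¬ S.Balanced := by
  intro hS
  have hne : p ≠ q := by
    rintro rfl
    exact S.loopless _ _ hpq
  have hne' : p ≠ r := by
    rintro rfl
    exact S.loopless _ _ hpr
  have hne'' : q ≠ r := by
    rintro rfl
    exact S.loopless _ _ hqr
  have := hS 1 ![p, q, r] ![s, u, t] (by
    intro i j hij
    fin_cases i <;> fin_cases j <;> simp_all) (by
    intro i
    fin_cases i
    · exact hpq
    · exact hqr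
    · exact S.symm _ _ _ hpr)
  rw [Fin.prod_univ_three] at this
  exact h (by rw [← this, mul_right_comm]; rfl)

namespace G8Vertex

theorem Joined.symm {M : SimpleGraph G8Vertex} {R : PlanarEmbedding M} {e f : Sym2 G8Vertex}
    {s : ℤˣ} (h : Joined R e f s) : Joined R f e s := by
  obtain ⟨he, hf, h⟩ := h
  exact ⟨hf, he, (strongConflictGraph G8 R).symm _ _ _ h⟩

/-- The data join the fragments `e` and `f`, in this or in the opposite order. -/
def SignedEdgeData.joins (k : ℕ) (A : SignedEdgeData) (e f : G8Vertex × G8Vertex) : Bool :=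
  A.isValid k &&
    ((edgeIndex A.e.1 A.e.2 == edgeIndex e.1 e.2 && edgeIndex A.f.1 A.f.2 == edgeIndex f.1 f.2) ||
    (edgeIndex A.e.1 A.e.2 == edgeIndex f.1 f.2 && edgeIndex A.f.1 A.f.2 == edgeIndex e.1 e.2))

theorem SignedEdgeData.joined_of_joins {M : SimpleGraph G8Vertex} {k : ℕ} {A : SignedEdgeData}
    {e f : G8Vertex × G8Vertex} (h : A.joins k e f = true) (hM : IsMaskOf M k)
    (R : PlanarEmbedding M) : Joined R s(e.1, e.2) s(f.1, f.2) A.sign := by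
  simp only [joins, Bool.and_eq_true, Bool.or_eq_true, beq_iff_eq] at h
  obtain ⟨hA, h⟩ := h
  have hj := A.joined hA hM R
  simp only [isValid, Bool.and_eq_true, decide_eq_true_eq] at hA
  have he : edgeIndex A.e.1 A.e.2 < 15 := hA.1.1.1.1.1.1
  have hf : edgeIndex A.f.1 A.f.2 < 15 := hA.1.1.1.1.1.2
  rw [edgeIndex_eq_iff he, edgeIndex_eq_iff hf, edgeIndex_eq_iff he, edgeIndex_eq_iff hf] at h
  rcases h with ⟨h₁, h₂⟩ | ⟨h₁, h₂⟩
  · rwa [h₁, h₂] at hj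
  · rw [h₁, h₂] at hj
    exact hj.symm

/-- The signed edges form an unbalanced cycle of length two or three. -/
def isUnbalanced (k : ℕ) : List (G8Vertex × G8Vertex) → List SignedEdgeData → Bool
  | [e, f], [A, B] => A.joins k e f && B.joins k e f && A.conflict && !B.conflict
  | [e, f, g], [A, B, C] => A.joins k e f && B.joins k e g && C.joins k f g &&
      (A.conflict ^^ B.conflict ^^ C.conflict)
  | _, _ => false

theorem not_balanced_of_isUnbalanced {M : SimpleGraph G8Vertex} {k : ℕ}
    {l : List (G8Vertex × G8Vertex)} {L : List SignedEdgeData} (h : isUnbalanced k l L = true)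
    (hM : IsMaskOf M k) (R : PlanarEmbedding M) : ¬ (strongConflictGraph G8 R).Balanced := by
  unfold isUnbalanced at h
  split at h
  · rename_i e f A B
    simp only [Bool.and_eq_true, Bool.not_eq_true'] at h
    obtain ⟨⟨⟨hA, hB⟩, hA'⟩, hB'⟩ := h
    obtain ⟨_, _, h₁⟩ := SignedEdgeData.joined_of_joins hA hM R
    obtain ⟨_, _, h₂⟩ := SignedEdgeData.joined_of_joins hB hM R
    rw [SignedEdgeData.sign, hA', cond_true] at h₁
    rw [SignedEdgeData.sign, hB', cond_false] at h₂
    exact SignedGraph.not_balanced_of_digon h₁ h₂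
  · rename_i e f g A B C
    simp only [Bool.and_eq_true] at h
    obtain ⟨⟨⟨hA, hB⟩, hC⟩, hs⟩ := h
    obtain ⟨_, _, h₁⟩ := SignedEdgeData.joined_of_joins hA hM R
    obtain ⟨_, _, h₂⟩ := SignedEdgeData.joined_of_joins hB hM R
    obtain ⟨_, _, h₃⟩ := SignedEdgeData.joined_of_joins hC hM R
    refine SignedGraph.not_balanced_of_triangle h₁ h₂ h₃ ?_
    unfold SignedEdgeData.sign
    revert hs
    cases A.conflict <;> cases B.conflict <;> cases C.conflict <;> decide
  · simp at h

/-- The images under the symmetries are checked as well, so the separation arguments need not be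
transported along automorphisms. -/
theorem isUnbalanced_maximalSubgraphData : ∀ i, symmetries.all (fun σ =>
    isUnbalanced (restMask (mapEdges σ (maximalSubgraphData i).removed))
      (mapEdges σ (maximalSubgraphData i).removed)
      ((maximalSubgraphData i).signedEdges.map fun A => A.map σ)) = true := by
  decide +kernel

end G8Vertex

open G8Vertex in
theorem proposition4 :
    -- each of the fourteen subgraphs is a maximal planar subgraph of `G₈`,
    (∀ i, IsMaximalPlanarSubgraph G8 (listedSubgraph i)) ∧
    -- no two of them are equivalent under the automorphism group of `G₈`,
    (∀ i j, EquivalentUnderAut G8 (listedSubgraph i) (listedSubgraph j) → i = j) ∧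
    -- they represent all maximal planar subgraphs of `G₈`, up to isomorphism,
    (∀ M, IsMaximalPlanarSubgraph G8 M → ∃ i, Nonempty (M ≃g listedSubgraph i)) ∧
    -- in fact, up to automorphisms of `G₈`, but for a second copy in `G₈` of the fifth one,
    (∀ M, IsMaximalPlanarSubgraph G8 M →
      (∃ i, EquivalentUnderAut G8 M (listedSubgraph i)) ∨
        EquivalentUnderAut G8 M siblingSubgraph) ∧
    -- and the strong conflict graph of each of them is unbalanced, for each planar embedding
    (∀ M, IsMaximalPlanarSubgraph G8 M → ∀ R : PlanarEmbedding M,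
      ¬ (strongConflictGraph G8 R).Balanced) := by
  have hclass : ∀ M, IsMaximalPlanarSubgraph G8 M →
      (∃ i, EquivalentUnderAut G8 M (listedSubgraph i)) ∨
        EquivalentUnderAut G8 M siblingSubgraph := by
    intro M hM
    obtain ⟨i, σ, hσ, rfl⟩ := exists_eq_of_isMaximalPlanarSubgraph hM
    have h := equivalentUnderAut_maximalSubgraph i hσ
    refine Fin.lastCases (fun h => ?_) (fun i h => ?_) i h
    · exact Or.inr (siblingSubgraph_eq ▸ h)
    · exact Or.inl ⟨i, listedSubgraph_eq i ▸ h⟩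
  refine ⟨fun i => ?_, fun i j h => ?_, fun M hM => ?_, hclass, fun M hM R => ?_⟩
  · rw [listedSubgraph_eq]
    exact isMaximalPlanarSubgraph_maximalSubgraph _
  · rw [listedSubgraph_eq, listedSubgraph_eq] at h
    exact eq_of_equivalentUnderAut h
  · rcases hclass M hM with ⟨i, φ, hφ⟩ | ⟨φ, hφ⟩
    · exact ⟨i, ⟨φ.toEquiv, fun {p q} => (hφ p q).symm⟩⟩
    · rw [siblingSubgraph_eq] at hφ
      refine ⟨4, ⟨?_⟩⟩
      rw [listedSubgraph_eq]
      exact (⟨φ.toEquiv, fun {p q} => (hφ p q).symm⟩ : M ≃g _).trans siblingIso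
  · obtain ⟨i, σ, hσ, rfl⟩ := exists_eq_of_isMaximalPlanarSubgraph hM
    exact not_balanced_of_isUnbalanced
      (List.all_eq_true.mp (isUnbalanced_maximalSubgraphData i) σ hσ) (isMaskOf_remaining _) R
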